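/- A \emph{closed framed curve} is a pair $(\gamma,V)$ in which $\gamma:\mathbb{R}/2\mathbb{Z}\to\mathbb{R}^3$ is a smooth immersion and $V:\mathbb{R}/2\mathbb{Z}\to\mathbb{R}^3$ is a smooth unit vector field with $\langle \gamma',V\rangle=0$. Write $\mathrm{d}s=\|\gamma'\|\,\mathrm{d}t$, $D_s=\|\gamma'\|^{-1}\frac{d}{dt}$, $$\kappa=\|D_s^2\gamma\|,\qquad \mathrm{tw}=\langle D_sV, D_s\gamma\times V\rangle,\qquad \mathrm{st}=\frac{1}{\|\gamma'\|}D_s\|\gamma'\|,$$ and define the generalized Kirchhoff energy $$\mathrm{E}(\gamma,V)=\int_0^2\left(\kappa^2+\mathrm{tw}^2+\mathrm{st}^2\right)\|\gamma'\|^2\,\mathrm{d}s .$$ For $\ell>0$ let $\mathcal{M}$ be the space of closed framed curves with $\mathrm{length}(\gamma)=\ell$ modulo translations, rotations (the group $\mathrm{SO}(3)$) and global frame twists (rotation of $V$ by one constant angle in the planes normal to $\gamma$); fixing the length $\ell$ realizes the quotient by scaling. Since $\mathrm{E}$ is invariant under these actions it induces $\mathrm{E}_{\mathcal{M}}:\mathcal{M}\to\mathbb{R}$.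 A point $m\in\mathcal{M}$ is \emph{critical} if $\frac{d}{d\varepsilon}\big|_{\varepsilon=0}\mathrm{E}_{\mathcal M}([\gamma_\varepsilon,V_\varepsilon])=0$ for every smooth one-parameter family $(\gamma_\varepsilon,V_\varepsilon)$ of closed framed curves of length $\ell$ with $[\gamma_0,V_0]=m$, and the values of $\mathrm{E}_{\mathcal M}$ at its critical points are its critical energy levels. \textbf{Statement.} For every $\ell>0$, the set of critical energy levels of $\mathrm{E}_{\mathcal{M}}$ is exactly $$\left\{\ \ell\cdot\frac{\pi^2(c^2+d^2)}{2}\ :\ c,d\in\mathbb{Z},\ c\equiv d \ (\mathrm{mod}\ 2),\ (c,d)\neq(0,0)\right\}.$$ In particular, with the normalization $\ell=2$ the critical energy levels are $\pi^2(c^2+d^2)$. -/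

import Mathlib

open scoped ContDiff InnerProductSpace

noncomputable section

namespace FramedCurve

/-- Euclidean three-space. -/
abbrev E3 : Type := EuclideanSpace ℝ (Fin 3)

/-- The standard cross product on Euclidean three-space. -/
def cross (a b : E3) : E3 :=
  WithLp.toLp 2 (crossProduct (WithLp.ofLp a) (WithLp.ofLp b))

/-- The derivative with respect to arclength along `γ`: `D_s f = f' / ‖γ'‖`. -/
def arcDeriv {F : Type*} [NormedAddCommGroup F] [NormedSpace ℝ F]
    (γ : ℝ → E3) (f : ℝ → F) (t : ℝ) : F :=
  ‖deriv γ t‖⁻¹ • deriv f t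

/-- The unit tangent `D_s γ`. -/
def unitTangent (γ : ℝ → E3) : ℝ → E3 := arcDeriv γ γ

/-- The curvature `κ = ‖D_s² γ‖`. -/
def curvature (γ : ℝ → E3) (t : ℝ) : ℝ := ‖arcDeriv γ (arcDeriv γ γ) t‖

/-- The twist rate `tw = ⟨D_s V, D_s γ × V⟩`. -/
def twistRate (γ V : ℝ → E3) (t : ℝ) : ℝ :=
  ⟪arcDeriv γ V t, cross (arcDeriv γ γ t) (V t)⟫_ℝ

/-- The relative stretch rate `st = (1 / ‖γ'‖) D_s ‖γ'‖`. -/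
def stretchRate (γ : ℝ → E3) (t : ℝ) : ℝ :=
  ‖deriv γ t‖⁻¹ * arcDeriv γ (fun s => ‖deriv γ s‖) t

/-- The length of `γ` over the parameter interval `[0, 2]`. -/
def length (γ : ℝ → E3) : ℝ := ∫ t in (0 : ℝ)..2, ‖deriv γ t‖

/-- The generalized Kirchhoff energy
`E(γ, V) = ∫ (κ² + tw² + st²) ‖γ'‖² ds`, with `ds = ‖γ'‖ dt`, over `[0, 2]`. -/
def energy (γ V : ℝ → E3) : ℝ :=
  ∫ t in (0 : ℝ)..2,
    ((curvature γ t ^ 2 + twistRate γ V t ^ 2 + stretchRate γ t ^ 2) * ‖deriv γ t‖ ^ 2)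
      * ‖deriv γ t‖

/-- A smoothly closed framed curve of length `ℓ`, parameterized by the circle `ℝ / 2ℤ`: an
immersed smooth loop together with a smooth unit normal vector field along it. -/
structure FramedLoop (ℓ : ℝ) where
  curve : ℝ → E3
  frame : ℝ → E3
  smooth_curve : ContDiff ℝ ∞ curve
  smooth_frame : ContDiff ℝ ∞ frame
  periodic_curve : Function.Periodic curve 2
  periodic_frame : Function.Periodic frame 2
  immersed : ∀ t, deriv curve t ≠ 0
  unit_frame : ∀ t, ‖frame t‖ = 1
  normal_frame : ∀ t, ⟪deriv curve t, frame t⟫_ℝ = 0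
  length_eq : length curve = ℓ

/-- The rotation of a vector field `V` along `γ` by the constant angle `θ` in the planes normal
to `γ`. -/
def twistFrame (θ : ℝ) (γ V : ℝ → E3) (t : ℝ) : E3 :=
  Real.cos θ • V t + Real.sin θ • cross (unitTangent γ t) (V t)

/-- Two framed loops are congruent if they differ by a translation, a rotation and a global frame
twist. -/
def Congruent {ℓ : ℝ} (x y : FramedLoop ℓ) : Prop :=
  ∃ (R : E3 ≃ₗᵢ[ℝ] E3) (b : E3) (θ : ℝ),
    LinearMap.det (R.toLinearEquiv : E3 →ₗ[ℝ] E3) = 1 ∧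
    (∀ t, y.curve t = R (x.curve t) + b) ∧
    (∀ t, y.frame t = R (twistFrame θ x.curve x.frame t))

/-! ### The energy is invariant under congruence -/

theorem inner_cross_eq_det (a b c : E3) :
    ⟪cross a b, c⟫_ℝ = (EuclideanSpace.basisFun (Fin 3) ℝ).toBasis.det ![a, b, c] := by
  rw [Module.Basis.det_apply, Matrix.det_fin_three]
  simp [cross, crossProduct, PiLp.inner_apply, Fin.sum_univ_three, Module.Basis.toMatrix_apply]
  ring

theorem map_cross (R : E3 ≃ₗᵢ[ℝ] E3)
    (hR : LinearMap.det (R.toLinearEquiv : E3 →ₗ[ℝ] E3) = 1) (a b : E3) :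
    R (cross a b) = cross (R a) (R b) := by
  refine ext_inner_right ℝ fun v => ?_
  obtain ⟨c, rfl⟩ := R.surjective v
  rw [R.inner_map_map, inner_cross_eq_det, inner_cross_eq_det]
  have h := (EuclideanSpace.basisFun (Fin 3) ℝ).toBasis.det_comp
    (R.toLinearEquiv : E3 →ₗ[ℝ] E3) ![a, b, c]
  rw [hR, one_mul] at h
  rw [← h]
  congr 1
  ext i : 1
  fin_cases i <;> rfl

theorem cross_add_smul_right (a b c : E3) (r s : ℝ) :
    cross a (r • b + s • c) = r • cross a b + s • cross a c := by
  simp [cross]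

theorem inner_cross_left (a b : E3) : ⟪a, cross a b⟫_ℝ = 0 := by
  simp [cross, crossProduct, PiLp.inner_apply, Fin.sum_univ_three]
  ring

theorem inner_cross_right (a b : E3) : ⟪b, cross a b⟫_ℝ = 0 := by
  simp [cross, crossProduct, PiLp.inner_apply, Fin.sum_univ_three]
  ring

theorem cross_cross_eq (a b : E3) :
    cross a (cross a b) = ⟪a, b⟫_ℝ • a - ⟪a, a⟫_ℝ • b := by
  ext i
  fin_cases i <;>
    simp [cross, crossProduct, PiLp.inner_apply, Fin.sum_univ_three,
      -inner_self_eq_norm_sq_to_K] <;> ring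

theorem inner_cross_cross (a b : E3) :
    ⟪cross a b, cross a b⟫_ℝ = ⟪a, a⟫_ℝ * ⟪b, b⟫_ℝ - ⟪a, b⟫_ℝ ^ 2 := by
  simp only [cross, crossProduct, PiLp.inner_apply, Fin.sum_univ_three]
  simp
  ring

namespace FramedLoop

variable {ℓ : ℝ}

theorem unitTangent_inner_self (x : FramedLoop ℓ) (t : ℝ) :
    ⟪unitTangent x.curve t, unitTangent x.curve t⟫_ℝ = 1 := by
  have h : ‖deriv x.curve t‖ ≠ 0 := norm_ne_zero_iff.2 (x.immersed t)
  rw [unitTangent, arcDeriv, real_inner_smul_left, real_inner_smul_right,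
    real_inner_self_eq_norm_sq]
  field_simp

theorem unitTangent_inner_frame (x : FramedLoop ℓ) (t : ℝ) :
    ⟪unitTangent x.curve t, x.frame t⟫_ℝ = 0 := by
  rw [unitTangent, arcDeriv, real_inner_smul_left, x.normal_frame, mul_zero]

theorem frame_inner_self (x : FramedLoop ℓ) (t : ℝ) : ⟪x.frame t, x.frame t⟫_ℝ = 1 := by
  rw [real_inner_self_eq_norm_sq, x.unit_frame, one_pow]

/-- The third vector of the adapted orthonormal frame. -/
def binormal (x : FramedLoop ℓ) (t : ℝ) : E3 := cross (unitTangent x.curve t) (x.frame t)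

theorem binormal_inner_self (x : FramedLoop ℓ) (t : ℝ) :
    ⟪x.binormal t, x.binormal t⟫_ℝ = 1 := by
  rw [binormal, inner_cross_cross, x.unitTangent_inner_self, x.frame_inner_self,
    x.unitTangent_inner_frame]
  norm_num

theorem frame_inner_binormal (x : FramedLoop ℓ) (t : ℝ) :
    ⟪x.frame t, x.binormal t⟫_ℝ = 0 := inner_cross_right _ _

theorem cross_unitTangent_binormal (x : FramedLoop ℓ) (t : ℝ) :
    cross (unitTangent x.curve t) (x.binormal t) = -x.frame t := by
  rw [binormal, cross_cross_eq, x.unitTangent_inner_self, x.unitTangent_inner_frame]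
  simp

theorem cross_unitTangent_twistFrame (x : FramedLoop ℓ) (θ t : ℝ) :
    cross (unitTangent x.curve t) (twistFrame θ x.curve x.frame t)
      = Real.cos θ • x.binormal t - Real.sin θ • x.frame t := by
  have h := x.cross_unitTangent_binormal t
  rw [twistFrame, cross_add_smul_right]
  change _ + Real.sin θ • cross _ (x.binormal t) = _
  rw [h, smul_neg, ← sub_eq_add_neg]
  rfl

theorem differentiable_frame (x : FramedLoop ℓ) : Differentiable ℝ x.frame :=
  x.smooth_frame.differentiable (by simp)

theorem smooth_deriv (x : FramedLoop ℓ) : ContDiff ℝ ∞ (deriv x.curve) :=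
  (contDiff_infty_iff_deriv.1 x.smooth_curve).2

theorem smooth_unitTangent (x : FramedLoop ℓ) : ContDiff ℝ ∞ (unitTangent x.curve) :=
  ((x.smooth_deriv.norm ℝ x.immersed).inv
    fun t => norm_ne_zero_iff.2 (x.immersed t)).smul x.smooth_deriv

theorem smooth_binormal (x : FramedLoop ℓ) : ContDiff ℝ ∞ x.binormal := by
  have hT := contDiff_euclidean.1 x.smooth_unitTangent
  have hV := contDiff_euclidean.1 x.smooth_frame
  refine contDiff_euclidean.2 fun i => ?_
  fin_cases i
  · simpa [binormal, cross, crossProduct] using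
      ((hT 1).mul (hV 2)).sub ((hT 2).mul (hV 1))
  · simpa [binormal, cross, crossProduct] using
      ((hT 2).mul (hV 0)).sub ((hT 0).mul (hV 2))
  · simpa [binormal, cross, crossProduct] using
      ((hT 0).mul (hV 1)).sub ((hT 1).mul (hV 0))

theorem differentiable_binormal (x : FramedLoop ℓ) : Differentiable ℝ x.binormal :=
  x.smooth_binormal.differentiable (by simp)

end FramedLoop

theorem inner_deriv_add_of_const {f g : ℝ → E3} (hf : Differentiable ℝ f)
    (hg : Differentiable ℝ g) {k : ℝ} (h : ∀ t, ⟪f t, g t⟫_ℝ = k) (t : ℝ) :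
    ⟪deriv f t, g t⟫_ℝ + ⟪f t, deriv g t⟫_ℝ = 0 := by
  have h1 := (hf t).hasDerivAt.inner ℝ (hg t).hasDerivAt
  have h2 : (fun t => ⟪f t, g t⟫_ℝ) = fun _ => k := funext h
  rw [h2] at h1
  have h3 := h1.unique (hasDerivAt_const t k)
  linarith

theorem deriv_map (R : E3 ≃ₗᵢ[ℝ] E3) (f : ℝ → E3) (b : E3) (t : ℝ) :
    deriv (fun s => R (f s) + b) t = R (deriv f t) := by
  rw [deriv_add_const]
  by_cases hf : DifferentiableAt ℝ f t
  · exact ((R.toContinuousLinearEquiv : E3 →L[ℝ] E3).hasFDerivAt.comp_hasDerivAt t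
      hf.hasDerivAt).deriv
  · rw [deriv_zero_of_not_differentiableAt hf, map_zero]
    refine deriv_zero_of_not_differentiableAt fun h => hf ?_
    have h' := (R.symm.toContinuousLinearEquiv : E3 →L[ℝ] E3).differentiableAt.comp t h
    simpa [Function.comp_def] using h'

theorem deriv_map' (R : E3 ≃ₗᵢ[ℝ] E3) (f : ℝ → E3) (t : ℝ) :
    deriv (fun s => R (f s)) t = R (deriv f t) := by
  simpa using deriv_map R f 0 t

theorem arcDeriv_map (R : E3 ≃ₗᵢ[ℝ] E3) (γ f : ℝ → E3) (b : E3) (t : ℝ) :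
    arcDeriv (fun s => R (γ s) + b) (fun s => R (f s)) t = R (arcDeriv γ f t) := by
  rw [arcDeriv, arcDeriv, deriv_map, deriv_map', R.norm_map, map_smul]

theorem unitTangent_map (R : E3 ≃ₗᵢ[ℝ] E3) (γ : ℝ → E3) (b : E3) (t : ℝ) :
    unitTangent (fun s => R (γ s) + b) t = R (unitTangent γ t) := by
  rw [unitTangent, unitTangent, arcDeriv, arcDeriv, deriv_map, R.norm_map, map_smul]

theorem curvature_map (R : E3 ≃ₗᵢ[ℝ] E3) (γ : ℝ → E3) (b : E3) (t : ℝ) :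
    curvature (fun s => R (γ s) + b) t = curvature γ t := by
  have h : arcDeriv (fun s => R (γ s) + b) (fun s => R (γ s) + b)
      = fun s => R (arcDeriv γ γ s) := funext (unitTangent_map R γ b)
  rw [curvature, curvature, h, arcDeriv_map, R.norm_map]

theorem stretchRate_map (R : E3 ≃ₗᵢ[ℝ] E3) (γ : ℝ → E3) (b : E3) (t : ℝ) :
    stretchRate (fun s => R (γ s) + b) t = stretchRate γ t := by
  simp only [stretchRate, arcDeriv, deriv_map, R.norm_map]

theorem twistRate_map (R : E3 ≃ₗᵢ[ℝ] E3)
    (hR : LinearMap.det (R.toLinearEquiv : E3 →ₗ[ℝ] E3) = 1) (γ V : ℝ → E3) (b : E3) (t : ℝ) :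
    twistRate (fun s => R (γ s) + b) (fun s => R (V s)) t = twistRate γ V t := by
  have h := unitTangent_map R γ b t
  rw [unitTangent, unitTangent] at h
  rw [twistRate, twistRate, arcDeriv_map, h, ← map_cross R hR, R.inner_map_map]

theorem twistRate_twistFrame {ℓ : ℝ} (x : FramedLoop ℓ) (θ t : ℝ) :
    twistRate x.curve (twistFrame θ x.curve x.frame) t = twistRate x.curve x.frame t := by
  have hV := x.differentiable_frame
  have hW := x.differentiable_binormal
  have hd : deriv (twistFrame θ x.curve x.frame) t
      = Real.cos θ • deriv x.frame t + Real.sin θ • deriv x.binormal t :=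
    (((hV t).hasDerivAt.const_smul (Real.cos θ)).add
      ((hW t).hasDerivAt.const_smul (Real.sin θ))).deriv
  have h1 := inner_deriv_add_of_const hV hV x.frame_inner_self t
  have h2 := inner_deriv_add_of_const hW hW x.binormal_inner_self t
  have h3 := inner_deriv_add_of_const hV hW x.frame_inner_binormal t
  have h4 := x.cross_unitTangent_twistFrame θ t
  have h5 := Real.sin_sq_add_cos_sq θ
  rw [real_inner_comm (deriv x.frame t)] at h1
  rw [real_inner_comm (deriv x.binormal t)] at h2
  rw [real_inner_comm (deriv x.binormal t)] at h3
  have h1' : ⟪deriv x.frame t, x.frame t⟫_ℝ = 0 := by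
    linarith
  have h2' : ⟪deriv x.binormal t, x.binormal t⟫_ℝ = 0 := by
    linarith
  change ⟪arcDeriv x.curve _ t, cross (unitTangent x.curve t) _⟫_ℝ
    = ⟪arcDeriv x.curve x.frame t, x.binormal t⟫_ℝ
  rw [arcDeriv, arcDeriv, hd, h4]
  simp only [inner_sub_right, inner_add_left, real_inner_smul_left, real_inner_smul_right]
  rw [h1', h2']
  linear_combination
    (-(‖deriv x.curve t‖⁻¹ * Real.sin θ ^ 2)) * h3
      + ‖deriv x.curve t‖⁻¹ * ⟪deriv x.frame t, x.binormal t⟫_ℝ * h5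

theorem Congruent.energy_eq {ℓ : ℝ} {x y : FramedLoop ℓ} (h : Congruent x y) :
    energy x.curve x.frame = energy y.curve y.frame := by
  obtain ⟨R, b, θ, hR, hc, hf⟩ := h
  have hc' : y.curve = fun s => R (x.curve s) + b := funext hc
  have hf' : y.frame = fun s => R (twistFrame θ x.curve x.frame s) := funext hf
  rw [hc', hf']
  simp only [energy, curvature_map, stretchRate_map, twistRate_map R hR, deriv_map, R.norm_map,
    twistRate_twistFrame]

/-! ### Congruence is an equivalence relation -/

theorem Congruent.refl {ℓ : ℝ} (x : FramedLoop ℓ) : Congruent x x := by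
  refine ⟨LinearIsometryEquiv.refl ℝ E3, 0, 0, ?_, ?_, ?_⟩
  · exact LinearMap.det_id
  · simp
  · simp [twistFrame]

theorem twistFrame_map (R : E3 ≃ₗᵢ[ℝ] E3)
    (hR : LinearMap.det (R.toLinearEquiv : E3 →ₗ[ℝ] E3) = 1) (γ V : ℝ → E3) (b : E3) (θ t : ℝ) :
    twistFrame θ (fun s => R (γ s) + b) (fun s => R (V s)) t = R (twistFrame θ γ V t) := by
  rw [twistFrame, twistFrame, unitTangent_map, ← map_cross R hR, map_add, map_smul, map_smul]

theorem twistFrame_twistFrame {ℓ : ℝ} (x : FramedLoop ℓ) (θ φ t : ℝ) :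
    twistFrame φ x.curve (twistFrame θ x.curve x.frame) t
      = twistFrame (φ + θ) x.curve x.frame t := by
  have h : twistFrame φ x.curve (twistFrame θ x.curve x.frame) t
      = Real.cos φ • twistFrame θ x.curve x.frame t
        + Real.sin φ • cross (unitTangent x.curve t) (twistFrame θ x.curve x.frame t) := rfl
  rw [h, x.cross_unitTangent_twistFrame]
  change Real.cos φ • (Real.cos θ • x.frame t + Real.sin θ • x.binormal t) + _
    = Real.cos (φ + θ) • x.frame t + Real.sin (φ + θ) • x.binormal t
  rw [Real.cos_add, Real.sin_add]
  module

theorem Congruent.symm {ℓ : ℝ} {x y : FramedLoop ℓ} (h : Congruent x y) : Congruent y x := by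
  obtain ⟨R, b, θ, hR, hc, hf⟩ := h
  have hc' : y.curve = fun s => R (x.curve s) + b := funext hc
  have hf' : y.frame = fun s => R (twistFrame θ x.curve x.frame s) := funext hf
  refine ⟨R.symm, -R.symm b, -θ, ?_, fun t => ?_, fun t => ?_⟩
  · have h1 := LinearEquiv.det_mul_det_symm R.toLinearEquiv
    rw [hR, one_mul] at h1
    exact h1
  · rw [hc t]; simp
  · rw [hf', hc', twistFrame_map R hR, R.symm_apply_apply, twistFrame_twistFrame]
    simp [twistFrame]

theorem Congruent.trans {ℓ : ℝ} {x y z : FramedLoop ℓ} (h : Congruent x y)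
    (h' : Congruent y z) : Congruent x z := by
  obtain ⟨R, b, θ, hR, hc, hf⟩ := h
  obtain ⟨S, c, φ, hS, hc2, hf2⟩ := h'
  have hc' : y.curve = fun s => R (x.curve s) + b := funext hc
  have hf' : y.frame = fun s => R (twistFrame θ x.curve x.frame s) := funext hf
  refine ⟨R.trans S, S b + c, φ + θ, ?_, fun t => ?_, fun t => ?_⟩
  · have h1 : ((R.trans S).toLinearEquiv : E3 →ₗ[ℝ] E3)
        = (S.toLinearEquiv : E3 →ₗ[ℝ] E3) * (R.toLinearEquiv : E3 →ₗ[ℝ] E3) := rfl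
    rw [h1, map_mul, hR, hS, one_mul]
  · rw [hc2, hc]; simp [add_assoc]
  · rw [hf2, hf', hc', twistFrame_map R hR, twistFrame_twistFrame]
    rfl

/-- Framed loops of length `ℓ` up to translation, rotation and global frame twisting. -/
def congruenceSetoid (ℓ : ℝ) : Setoid (FramedLoop ℓ) where
  r := Congruent
  iseqv := ⟨Congruent.refl, Congruent.symm, Congruent.trans⟩

/-- The moduli space of framed loops. The quotient by scaling is realized by fixing the
length `ℓ`. -/
def Moduli (ℓ : ℝ) : Type := Quotient (congruenceSetoid ℓ)

/-- The class of a framed loop in the moduli space. -/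
def FramedLoop.toModuli {ℓ : ℝ} (x : FramedLoop ℓ) : Moduli ℓ :=
  Quotient.mk (congruenceSetoid ℓ) x

/-- The functional induced by the generalized Kirchhoff energy on the moduli space. -/
def moduliEnergy {ℓ : ℝ} (m : Moduli ℓ) : ℝ :=
  Quotient.lift (s := congruenceSetoid ℓ) (fun x : FramedLoop ℓ => energy x.curve x.frame)
    (fun _ _ h => Congruent.energy_eq h) m

/-- A smooth one-parameter family of framed loops of length `ℓ`. -/
def IsSmoothFamily {ℓ : ℝ} (F : ℝ → FramedLoop ℓ) : Prop :=
  ContDiff ℝ ∞ (fun p : ℝ × ℝ => (F p.1).curve p.2) ∧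
  ContDiff ℝ ∞ (fun p : ℝ × ℝ => (F p.1).frame p.2)

/-- A point of the moduli space is critical for the induced energy if the energy has derivative
zero along every smooth path in the moduli space (the projection of a smooth family of framed
loops of length `ℓ`) through the point. -/
def IsCriticalPoint {ℓ : ℝ} (m : Moduli ℓ) : Prop :=
  ∀ F : ℝ → FramedLoop ℓ, IsSmoothFamily F → (F 0).toModuli = m →
    HasDerivAt (fun ε : ℝ => moduliEnergy (F ε).toModuli) 0 0

/-- The set of critical energy levels, that is, the values of the induced energy at its critical
points. -/
def criticalEnergyLevels (ℓ : ℝ) : Set ℝ :=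
  {e | ∃ m : Moduli ℓ, IsCriticalPoint m ∧ moduliEnergy m = e}

end FramedCurve

end

/-! Both inclusions rest on writing the energy, with respect to the parameter, as `∫ r|T'|² +
r⟨V',B⟩² + r'²/r`, where `r = ‖γ'‖`, `T` is the unit tangent and `B = T × V`
(`FramedLoop.energy_eq_integral`).

The listed values are critical because of uniformly twisted circles: planar circles of constant
speed, covered `m ≠ 0` times, whose frame turns at constant rate `nπ`. At such a loop the first
variation of the density is a constant times the variation of `r` plus a `t`-derivative of a
periodic function. Both integrate to zero, the former since the length is fixed
(`IsTwistedCircle.hasDerivAt_energy`). The energy is `ℓπ²(m² + n²)`, and `c = n - m`, `d = n + m`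
turns this into the stated form.

For the converse, a framed loop is lifted to a spinor `(a, b) : ℝ → ℂ²` through the Hopf map, which
doubles the frame: `γ'` and `‖γ'‖ V` are quadratic in `(a, b)` and `‖γ'‖ = |a|² + |b|²`. The lift is
periodic up to a common sign `σ = ±1`. Three facts make the problem linear. The energy becomes `4 ∫
|a'|² + |b'|²` (`IsSpinor.energy_eq`). The curve closes up with length `ℓ` exactly when `a` and `b`
are orthogonal in `L²` with squared norms `ℓ/2` (`integral_spinTangent`, `integral_spinSpeed`).
Every such spinor near the given one again induces a framed loop (`exists_family`). So the task is
to find the critical values of a Dirichlet energy on orthogonal pairs of fixed norm.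

Rotating `a` towards a third orthogonal function shows that, at a critical pair, `-a''` lies in the
span of `a` and `b`; by symmetry so does `-b''`. Hence `-d²/dt²` acts on this span by a Hermitian `2
× 2` matrix. Its eigenfunctions have multiplier `σ`, so its eigenvalues are `(πc/2)²` and `(πd/2)²`,
with `c` and `d` both even or both odd according to `σ`. The trace of the matrix is `2/ℓ` times a
quarter of the energy, which gives the formula. If `c = d = 0`, both components would be constant,
and nonzero constants are not orthogonal. -/

noncomputable section

namespace FramedCurve

/-! ### Smooth functions of two real variables -/

section TwoVariables

variable {F : Type*} [NormedAddCommGroup F] [NormedSpace ℝ F]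

/-- The partial derivative in the first variable. -/
def partialFst (u : ℝ × ℝ → F) (p : ℝ × ℝ) : F := fderiv ℝ u p (1, 0)

/-- The partial derivative in the second variable. -/
def partialSnd (u : ℝ × ℝ → F) (p : ℝ × ℝ) : F := fderiv ℝ u p (0, 1)

variable {u : ℝ × ℝ → F}

theorem contDiff_partialFst (hu : ContDiff ℝ ∞ u) : ContDiff ℝ ∞ (partialFst u) :=
  (hu.fderiv_right (m := ∞) (by simp)).clm_apply contDiff_const

theorem contDiff_partialSnd (hu : ContDiff ℝ ∞ u) : ContDiff ℝ ∞ (partialSnd u) :=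
  (hu.fderiv_right (m := ∞) (by simp)).clm_apply contDiff_const

theorem hasDerivAt_partialFst (hu : ContDiff ℝ ∞ u) (e t : ℝ) :
    HasDerivAt (fun e => u (e, t)) (partialFst u (e, t)) e := by
  have h1 : HasFDerivAt u (fderiv ℝ u (e, t)) (e, t) :=
    (hu.differentiable (by simp) _).hasFDerivAt
  have h2 : HasDerivAt (fun e : ℝ => (e, t)) ((1 : ℝ), (0 : ℝ)) e :=
    (hasDerivAt_id e).prodMk (hasDerivAt_const e t)
  exact h1.comp_hasDerivAt e h2

theorem hasDerivAt_partialSnd (hu : ContDiff ℝ ∞ u) (e t : ℝ) :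
    HasDerivAt (fun t => u (e, t)) (partialSnd u (e, t)) t := by
  have h1 : HasFDerivAt u (fderiv ℝ u (e, t)) (e, t) :=
    (hu.differentiable (by simp) _).hasFDerivAt
  have h2 : HasDerivAt (fun t : ℝ => (e, t)) ((0 : ℝ), (1 : ℝ)) t :=
    (hasDerivAt_const t e).prodMk (hasDerivAt_id t)
  exact h1.comp_hasDerivAt t h2

theorem partialFst_partialSnd (hu : ContDiff ℝ ∞ u) (p : ℝ × ℝ) :
    partialFst (partialSnd u) p = partialSnd (partialFst u) p := by
  have hd : DifferentiableAt ℝ (fderiv ℝ u) p :=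
    (hu.fderiv_right (m := ∞) (by simp)).differentiable (by simp) p
  have h : IsSymmSndFDerivAt ℝ u p :=
    hu.contDiffAt.isSymmSndFDerivAt (by
      rw [minSmoothness_of_isRCLikeNormedField]
      exact WithTop.coe_le_coe.2 (le_top : (2 : ℕ∞) ≤ ⊤))
  have key : ∀ v w : ℝ × ℝ, fderiv ℝ (fun q => fderiv ℝ u q v) p w = fderiv ℝ (fderiv ℝ u) p w v := by
    intro v w
    rw [fderiv_clm_apply hd (differentiableAt_const v)]
    simp
  change fderiv ℝ (fun q => fderiv ℝ u q (0, 1)) p (1, 0)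
    = fderiv ℝ (fun q => fderiv ℝ u q (1, 0)) p (0, 1)
  rw [key, key]
  exact h _ _

theorem contDiff_slice (hu : ContDiff ℝ ∞ u) (e : ℝ) : ContDiff ℝ ∞ fun t => u (e, t) :=
  hu.comp (contDiff_const.prodMk contDiff_id)

theorem hasDerivAt_integral_of_contDiff {L : ℝ × ℝ → ℝ} (hL : ContDiff ℝ ∞ L) (a b e : ℝ) :
    HasDerivAt (fun e => ∫ t in a..b, L (e, t)) (∫ t in a..b, partialFst L (e, t)) e := by
  have hc : Continuous (partialFst L) := (contDiff_partialFst hL).continuous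
  obtain ⟨C, hC⟩ := ((isCompact_closedBall e 1).prod (isCompact_uIcc (a := a) (b := b)))
    |>.exists_bound_of_continuousOn hc.continuousOn
  have hLc := hL.continuous
  refine (intervalIntegral.hasDerivAt_integral_of_dominated_loc_of_deriv_le
    (F := fun e t => L (e, t)) (F' := fun e t => partialFst L (e, t)) (bound := fun _ => C)
    (Metric.ball_mem_nhds e one_pos) ?_ ?_ ?_ ?_ ?_ ?_).2
  · exact Filter.Eventually.of_forall fun x =>
      (by fun_prop : Continuous fun t => L (x, t)).aestronglyMeasurable
  · exact (by fun_prop : Continuous fun t => L (e, t)).intervalIntegrable _ _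
  · exact (by fun_prop : Continuous fun t => partialFst L (e, t)).aestronglyMeasurable
  · exact Filter.Eventually.of_forall fun t ht x hx =>
      hC (x, t) ⟨Metric.ball_subset_closedBall hx, Set.uIoc_subset_uIcc ht⟩
  · exact intervalIntegrable_const
  · exact Filter.Eventually.of_forall fun t _ x _ => hasDerivAt_partialFst hL x t

theorem integral_partialSnd_eq_zero {u : ℝ × ℝ → ℝ} (hu : ContDiff ℝ ∞ u) (e : ℝ)
    (hp : Function.Periodic (fun t => u (e, t)) 2) :
    ∫ t in (0 : ℝ)..2, partialSnd u (e, t) = 0 := by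
  have hc : Continuous (partialSnd u) := (contDiff_partialSnd hu).continuous
  rw [intervalIntegral.integral_eq_sub_of_hasDerivAt
    (fun t _ => hasDerivAt_partialSnd hu e t)
    ((by fun_prop : Continuous fun t => partialSnd u (e, t)).intervalIntegrable _ _)]
  have := hp 0
  simp only [zero_add] at this
  rw [this, sub_self]

end TwoVariables

/-! ### The energy density -/

theorem contDiff_cross {G : Type*} [NormedAddCommGroup G] [NormedSpace ℝ G] {f g : G → E3}
    (hf : ContDiff ℝ ∞ f) (hg : ContDiff ℝ ∞ g) : ContDiff ℝ ∞ fun p => cross (f p) (g p) := by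
  have hT := contDiff_euclidean.1 hf
  have hV := contDiff_euclidean.1 hg
  refine contDiff_euclidean.2 fun i => ?_
  fin_cases i
  · simpa [cross, crossProduct] using ((hT 1).mul (hV 2)).sub ((hT 2).mul (hV 1))
  · simpa [cross, crossProduct] using ((hT 2).mul (hV 0)).sub ((hT 0).mul (hV 2))
  · simpa [cross, crossProduct] using ((hT 0).mul (hV 1)).sub ((hT 1).mul (hV 0))

namespace FramedLoop

variable {ℓ : ℝ}

theorem speed_pos (x : FramedLoop ℓ) (t : ℝ) : 0 < ‖deriv x.curve t‖ :=
  norm_pos_iff.2 (x.immersed t)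

theorem smooth_speed (x : FramedLoop ℓ) : ContDiff ℝ ∞ fun t => ‖deriv x.curve t‖ :=
  x.smooth_deriv.norm ℝ x.immersed

theorem deriv_curve_eq (x : FramedLoop ℓ) (t : ℝ) :
    deriv x.curve t = ‖deriv x.curve t‖ • unitTangent x.curve t := by
  rw [unitTangent, arcDeriv, smul_smul, mul_inv_cancel₀ (x.speed_pos t).ne', one_smul]

theorem periodic_deriv (x : FramedLoop ℓ) : Function.Periodic (deriv x.curve) 2 := by
  intro t
  rw [← deriv_comp_add_const]
  congr 1
  exact funext x.periodic_curve

theorem periodic_unitTangent (x : FramedLoop ℓ) :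
    Function.Periodic (unitTangent x.curve) 2 := by
  intro t
  simp only [unitTangent, arcDeriv, x.periodic_deriv t]

theorem periodic_binormal (x : FramedLoop ℓ) : Function.Periodic x.binormal 2 := by
  intro t
  simp only [binormal, x.periodic_unitTangent t, x.periodic_frame t]

/-- The energy density with respect to the parameter of the curve. -/
theorem energy_density_eq (x : FramedLoop ℓ) (t : ℝ) :
    ((curvature x.curve t ^ 2 + twistRate x.curve x.frame t ^ 2 + stretchRate x.curve t ^ 2)
      * ‖deriv x.curve t‖ ^ 2) * ‖deriv x.curve t‖
    = ‖deriv x.curve t‖ * ⟪deriv (unitTangent x.curve) t, deriv (unitTangent x.curve) t⟫_ℝ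
      + ‖deriv x.curve t‖ * ⟪deriv x.frame t, x.binormal t⟫_ℝ ^ 2
      + deriv (fun s => ‖deriv x.curve s‖) t ^ 2 / ‖deriv x.curve t‖ := by
  have hr := (x.speed_pos t).ne'
  have h1 : curvature x.curve t ^ 2 = (‖deriv x.curve t‖⁻¹) ^ 2 *
      ⟪deriv (unitTangent x.curve) t, deriv (unitTangent x.curve) t⟫_ℝ := by
    rw [curvature, arcDeriv, norm_smul, mul_pow, real_inner_self_eq_norm_sq, norm_inv, norm_norm]
    rfl
  have h2 : twistRate x.curve x.frame t
      = ‖deriv x.curve t‖⁻¹ * ⟪deriv x.frame t, x.binormal t⟫_ℝ := by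
    rw [twistRate, arcDeriv, real_inner_smul_left]
    rfl
  rw [h1, h2, stretchRate, arcDeriv, smul_eq_mul]
  field_simp

theorem energy_eq_integral (x : FramedLoop ℓ) :
    energy x.curve x.frame = ∫ t in (0 : ℝ)..2,
      (‖deriv x.curve t‖ * ⟪deriv (unitTangent x.curve) t, deriv (unitTangent x.curve) t⟫_ℝ
      + ‖deriv x.curve t‖ * ⟪deriv x.frame t, x.binormal t⟫_ℝ ^ 2
      + deriv (fun s => ‖deriv x.curve s‖) t ^ 2 / ‖deriv x.curve t‖) := by
  rw [energy]
  simp only [x.energy_density_eq]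

end FramedLoop

/-! ### Adapted orthonormal frames -/

theorem inner_eq_sum (p q : E3) : ⟪p, q⟫_ℝ = p 0 * q 0 + p 1 * q 1 + p 2 * q 2 := by
  simp [PiLp.inner_apply, Fin.sum_univ_three]
  ring

theorem cross_apply_zero (p q : E3) : cross p q 0 = p 1 * q 2 - p 2 * q 1 := by
  simp [cross, crossProduct]

theorem cross_apply_one (p q : E3) : cross p q 1 = p 2 * q 0 - p 0 * q 2 := by
  simp [cross, crossProduct]

theorem cross_apply_two (p q : E3) : cross p q 2 = p 0 * q 1 - p 1 * q 0 := by
  simp [cross, crossProduct]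

/-- The rows of the matrix with columns `T`, `V`, `T × V` are orthonormal. -/
theorem frame_completeness {T V : E3} (hT : ⟪T, T⟫_ℝ = 1) (hV : ⟪V, V⟫_ℝ = 1)
    (hTV : ⟪T, V⟫_ℝ = 0) (i j : Fin 3) :
    T i * T j + V i * V j + cross T V i * cross T V j = if i = j then 1 else 0 := by
  have hB : ⟪cross T V, cross T V⟫_ℝ = 1 := by
    rw [inner_cross_cross, hT, hV, hTV]; norm_num
  have hTB := inner_cross_left T V
  have hVB := inner_cross_right T V
  let M : Matrix (Fin 3) (Fin 3) ℝ := Matrix.of ![T.ofLp, V.ofLp, (cross T V).ofLp]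
  have h1 : M * M.transpose = 1 := by
    rw [inner_eq_sum] at hT hV hTV hB hTB hVB
    ext i j
    fin_cases i <;> fin_cases j <;>
      simp [M, Matrix.mul_apply, Fin.sum_univ_three] <;> linarith
  have h2 : M.transpose * M = 1 := mul_eq_one_comm.1 h1
  have h3 := congrFun (congrFun h2 i) j
  rw [Matrix.one_apply] at h3
  rw [← h3]
  simp [M, Matrix.mul_apply, Fin.sum_univ_three]

theorem inner_eq_frame_sum {T V : E3} (hT : ⟪T, T⟫_ℝ = 1) (hV : ⟪V, V⟫_ℝ = 1)
    (hTV : ⟪T, V⟫_ℝ = 0) (p q : E3) :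
    ⟪p, q⟫_ℝ = ⟪p, T⟫_ℝ * ⟪q, T⟫_ℝ + ⟪p, V⟫_ℝ * ⟪q, V⟫_ℝ
      + ⟪p, cross T V⟫_ℝ * ⟪q, cross T V⟫_ℝ := by
  have h := frame_completeness hT hV hTV
  have h00 := h 0 0
  have h01 := h 0 1
  have h02 := h 0 2
  have h11 := h 1 1
  have h12 := h 1 2
  have h22 := h 2 2
  simp only [if_true, Fin.reduceEq, if_false] at h00 h01 h02 h11 h12 h22
  simp only [inner_eq_sum]
  linear_combination -(p 0 * q 0 * h00) - (p 0 * q 1 + p 1 * q 0) * h01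
    - (p 0 * q 2 + p 2 * q 0) * h02 - p 1 * q 1 * h11 - (p 1 * q 2 + p 2 * q 1) * h12
    - p 2 * q 2 * h22

theorem cross_frame_binormal {T V : E3} (hV : ⟪V, V⟫_ℝ = 1) (hTV : ⟪T, V⟫_ℝ = 0) :
    cross V (cross T V) = T := by
  have h : cross V (cross T V) = ⟪V, V⟫_ℝ • T - ⟪T, V⟫_ℝ • V := by
    ext i
    simp only [inner_eq_sum]
    fin_cases i <;> simp [cross, crossProduct] <;> ring
  rw [h, hV, hTV]
  simp

/-- The Binet–Cauchy identity; it turns the commutator of two frame variations into a triple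
product. -/
theorem inner_mul_sub_inner_mul (a b c d : E3) :
    ⟪a, c⟫_ℝ * ⟪b, d⟫_ℝ - ⟪a, d⟫_ℝ * ⟪b, c⟫_ℝ = ⟪cross a b, cross c d⟫_ℝ := by
  simp only [inner_eq_sum, cross_apply_zero, cross_apply_one, cross_apply_two]
  ring

theorem inner_cross_rotate (a b c : E3) : ⟪a, cross b c⟫_ℝ = ⟪cross a b, c⟫_ℝ := by
  simp only [inner_eq_sum, cross_apply_zero, cross_apply_one, cross_apply_two]
  ring

/-- The commutator identity behind the first variation of the total twist: `T₁, V₁, B₁` and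
`T₂, V₂, B₂` are two infinitesimal variations of an orthonormal frame `T, V, T × V`. -/
theorem inner_variation_sub {T V T₁ V₁ B₁ T₂ V₂ B₂ : E3} (hT : ⟪T, T⟫_ℝ = 1)
    (hV : ⟪V, V⟫_ℝ = 1) (hTV : ⟪T, V⟫_ℝ = 0)
    (hV1 : ⟪V₁, V⟫_ℝ = 0) (hV2 : ⟪V₂, V⟫_ℝ = 0)
    (hB1 : ⟪B₁, cross T V⟫_ℝ = 0) (hB2 : ⟪B₂, cross T V⟫_ℝ = 0)
    (hTV1 : ⟪T₁, V⟫_ℝ + ⟪T, V₁⟫_ℝ = 0) (hTV2 : ⟪T₂, V⟫_ℝ + ⟪T, V₂⟫_ℝ = 0)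
    (hTB1 : ⟪T₁, cross T V⟫_ℝ + ⟪T, B₁⟫_ℝ = 0) (hTB2 : ⟪T₂, cross T V⟫_ℝ + ⟪T, B₂⟫_ℝ = 0) :
    ⟪V₂, B₁⟫_ℝ - ⟪V₁, B₂⟫_ℝ = ⟪cross T T₂, T₁⟫_ℝ := by
  -- In the frame `T, V, T × V` each `Vᵢ` has no `V`-component and each `Bᵢ` no `T × V`-component,
  -- so only products of `T`-components survive. Orthogonality turns these into components of `T₁,
  -- T₂`, and `V × (T × V) = T` closes the computation.
  have e0 := inner_mul_sub_inner_mul V (cross T V) T₂ T₁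
  rw [cross_frame_binormal hV hTV] at e0
  rw [← inner_cross_rotate, ← e0, inner_eq_frame_sum hT hV hTV V₂,
    inner_eq_frame_sum hT hV hTV V₁, hV1, hV2, hB1, hB2]
  have e1 : ⟪V₁, T⟫_ℝ = -⟪V, T₁⟫_ℝ := by
    rw [real_inner_comm T V₁, real_inner_comm T₁ V]; linarith
  have e2 : ⟪V₂, T⟫_ℝ = -⟪V, T₂⟫_ℝ := by
    rw [real_inner_comm T V₂, real_inner_comm T₂ V]; linarith
  have e3 : ⟪B₁, T⟫_ℝ = -⟪cross T V, T₁⟫_ℝ := by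
    rw [real_inner_comm T B₁, real_inner_comm T₁ (cross T V)]; linarith
  have e4 : ⟪B₂, T⟫_ℝ = -⟪cross T V, T₂⟫_ℝ := by
    rw [real_inner_comm T B₂, real_inner_comm T₂ (cross T V)]; linarith
  rw [e1, e2, e3, e4]
  ring

/-! ### Uniformly twisted circles are critical -/

/-- The curve has constant speed, its unit tangent rotates uniformly about a fixed axis and its
frame twists at a constant rate. -/
structure IsTwistedCircle {ℓ : ℝ} (x : FramedLoop ℓ) (k τ : ℝ) : Prop where
  speed : ∀ t, ‖deriv x.curve t‖ = ℓ / 2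
  tangent : ∀ t, deriv (deriv (unitTangent x.curve)) t = -(k ^ 2) • unitTangent x.curve t
  axis : ∃ e, ∀ t, cross (unitTangent x.curve t) (deriv (unitTangent x.curve) t) = e
  twist : ∀ t, ⟪deriv x.frame t, x.binormal t⟫_ℝ = τ

theorem inner_deriv_frame_binormal {ℓ : ℝ} (x : FramedLoop ℓ) (t : ℝ) :
    ⟪deriv x.frame t, x.binormal t⟫_ℝ = ‖deriv x.curve t‖ * twistRate x.curve x.frame t := by
  have hr := (x.speed_pos t).ne'
  rw [twistRate, arcDeriv, real_inner_smul_left, mul_inv_cancel_left₀ hr]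
  rfl

/-- Needed because criticality is tested on families whose member at `0` is only congruent to the
given loop. -/
theorem IsTwistedCircle.congr {ℓ k τ : ℝ} {x y : FramedLoop ℓ} (hx : IsTwistedCircle x k τ)
    (h : Congruent x y) : IsTwistedCircle y k τ := by
  obtain ⟨R, b, θ, hR, hc, hf⟩ := h
  have hc' : y.curve = fun s => R (x.curve s) + b := funext hc
  have hf' : y.frame = fun s => R (twistFrame θ x.curve x.frame s) := funext hf
  have hT : unitTangent y.curve = fun s => R (unitTangent x.curve s) := by
    rw [hc']; exact funext (unitTangent_map R x.curve b)
  have hT' : deriv (unitTangent y.curve) = fun s => R (deriv (unitTangent x.curve) s) := by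
    rw [hT]; exact funext (deriv_map' R _)
  have hs : ∀ t, ‖deriv y.curve t‖ = ‖deriv x.curve t‖ := by
    intro t; rw [hc', deriv_map, R.norm_map]
  refine ⟨fun t => (hs t).trans (hx.speed t), fun t => ?_, ?_, fun t => ?_⟩
  · rw [hT', deriv_map', hx.tangent, hT, map_smul]
  · obtain ⟨e, he⟩ := hx.axis
    refine ⟨R e, fun t => ?_⟩
    rw [hT', hT, ← map_cross R hR, he]
  · have h := hx.twist t
    rw [inner_deriv_frame_binormal] at h ⊢
    rw [hs, ← h, hc', hf', twistRate_map R hR, twistRate_twistFrame]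

/-- Differentiate `⟨T, T'⟩ = 0` and insert `T'' = -k² T`. -/
theorem IsTwistedCircle.inner_deriv_tangent {ℓ k τ : ℝ} {x : FramedLoop ℓ}
    (hx : IsTwistedCircle x k τ) (t : ℝ) :
    ⟪deriv (unitTangent x.curve) t, deriv (unitTangent x.curve) t⟫_ℝ = k ^ 2 := by
  have hT : Differentiable ℝ (unitTangent x.curve) :=
    x.smooth_unitTangent.differentiable (by simp)
  have hT' : Differentiable ℝ (deriv (unitTangent x.curve)) :=
    (contDiff_infty_iff_deriv.1 x.smooth_unitTangent).2.differentiable (by simp)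
  have h1 : ∀ t, ⟪unitTangent x.curve t, deriv (unitTangent x.curve) t⟫_ℝ = 0 := by
    intro t
    have := inner_deriv_add_of_const hT hT x.unitTangent_inner_self t
    rw [real_inner_comm] at this
    linarith
  have h2 := inner_deriv_add_of_const hT hT' h1 t
  rw [hx.tangent, real_inner_smul_right, x.unitTangent_inner_self] at h2
  linarith

theorem IsTwistedCircle.energy_eq {ℓ k τ : ℝ} {x : FramedLoop ℓ}
    (hx : IsTwistedCircle x k τ) :
    energy x.curve x.frame = ℓ * (k ^ 2 + τ ^ 2) := by
  rw [x.energy_eq_integral]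
  simp only [hx.inner_deriv_tangent, hx.twist, hx.speed]
  simp
  ring

/-! ### First variation at a twisted circle -/

theorem inner_partialFst_add {f g : ℝ × ℝ → E3} (hf : ContDiff ℝ ∞ f) (hg : ContDiff ℝ ∞ g)
    {c : ℝ} (h : ∀ p, ⟪f p, g p⟫_ℝ = c) (p : ℝ × ℝ) :
    ⟪partialFst f p, g p⟫_ℝ + ⟪f p, partialFst g p⟫_ℝ = 0 := by
  have h1 := (hasDerivAt_partialFst hf p.1 p.2).inner ℝ (hasDerivAt_partialFst hg p.1 p.2)
  simp only [h] at h1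
  have h2 := h1.unique (hasDerivAt_const p.1 c)
  linarith

theorem inner_partialSnd_add {f g : ℝ × ℝ → E3} (hf : ContDiff ℝ ∞ f) (hg : ContDiff ℝ ∞ g)
    {c : ℝ} (h : ∀ p, ⟪f p, g p⟫_ℝ = c) (p : ℝ × ℝ) :
    ⟪partialSnd f p, g p⟫_ℝ + ⟪f p, partialSnd g p⟫_ℝ = 0 := by
  have h1 := (hasDerivAt_partialSnd hf p.1 p.2).inner ℝ (hasDerivAt_partialSnd hg p.1 p.2)
  simp only [h] at h1
  have h2 := h1.unique (hasDerivAt_const p.2 c)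
  linarith

/-- The varied density is `(k² + τ²) ∂_ε r + ∂_t U` with `U` periodic. The first term integrates to
zero because the length does not vary, the second by periodicity. -/
theorem IsTwistedCircle.hasDerivAt_energy {ℓ k τ : ℝ} {F : ℝ → FramedLoop ℓ}
    (hF : IsSmoothFamily F) (h0 : IsTwistedCircle (F 0) k τ) :
    HasDerivAt (fun ε => energy (F ε).curve (F ε).frame) 0 0 := by
  obtain ⟨hγ, hV⟩ := hF
  obtain ⟨γ, hγe⟩ : ∃ γ : ℝ × ℝ → E3, γ = fun p => (F p.1).curve p.2 := ⟨_, rfl⟩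
  obtain ⟨V, hVe⟩ : ∃ V : ℝ × ℝ → E3, V = fun p => (F p.1).frame p.2 := ⟨_, rfl⟩
  rw [← hγe] at hγ
  rw [← hVe] at hV
  have hγs : ∀ e t, (F e).curve t = γ (e, t) := fun e t => by rw [hγe]
  have hVs : ∀ e t, (F e).frame t = V (e, t) := fun e t => by rw [hVe]
  obtain ⟨X, hXe⟩ : ∃ X : ℝ × ℝ → E3, X = partialSnd γ := ⟨_, rfl⟩
  have hX : ContDiff ℝ ∞ X := hXe ▸ contDiff_partialSnd hγ
  have hXd : ∀ e t, deriv (F e).curve t = X (e, t) := by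
    intro e t
    rw [show (F e).curve = fun t => γ (e, t) from funext (hγs e), hXe]
    exact (hasDerivAt_partialSnd hγ e t).deriv
  have hX0 : ∀ p, X p ≠ 0 := fun p => hXd p.1 p.2 ▸ (F p.1).immersed p.2
  obtain ⟨r, hre⟩ : ∃ r : ℝ × ℝ → ℝ, r = fun p => ‖X p‖ := ⟨_, rfl⟩
  have hr : ContDiff ℝ ∞ r := hre ▸ hX.norm ℝ hX0
  have hr0 : ∀ p, r p ≠ 0 := fun p => by rw [hre]; exact norm_ne_zero_iff.2 (hX0 p)
  obtain ⟨T, hTe⟩ : ∃ T : ℝ × ℝ → E3, T = fun p => (r p)⁻¹ • X p := ⟨_, rfl⟩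
  have hT : ContDiff ℝ ∞ T := hTe ▸ (hr.inv hr0).smul hX
  have hTs : ∀ e, unitTangent (F e).curve = fun t => T (e, t) := by
    intro e; funext t
    rw [unitTangent, arcDeriv, hXd, hTe, hre]
  obtain ⟨B, hBe⟩ : ∃ B : ℝ × ℝ → E3, B = fun p => cross (T p) (V p) := ⟨_, rfl⟩
  have hB : ContDiff ℝ ∞ B := hBe ▸ contDiff_cross hT hV
  have hBs : ∀ e t, (F e).binormal t = B (e, t) := by
    intro e t
    rw [FramedLoop.binormal, hTs, hVs, hBe]
  have hTd : ∀ e t, deriv (unitTangent (F e).curve) t = partialSnd T (e, t) := by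
    intro e t; rw [hTs]; exact (hasDerivAt_partialSnd hT e t).deriv
  have hVd : ∀ e t, deriv (F e).frame t = partialSnd V (e, t) := by
    intro e t
    rw [show (F e).frame = fun t => V (e, t) from funext (hVs e)]
    exact (hasDerivAt_partialSnd hV e t).deriv
  have hrs : ∀ e t, ‖deriv (F e).curve t‖ = r (e, t) := fun e t => by rw [hXd, hre]
  have hrd : ∀ e t, deriv (fun s => r (e, s)) t = partialSnd r (e, t) := by
    intro e t
    exact (hasDerivAt_partialSnd hr e t).deriv
  have hT' := contDiff_partialSnd hT
  have hV' := contDiff_partialSnd hV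
  have hr' := contDiff_partialSnd hr
  have hT1 := contDiff_partialFst hT
  have hV1 := contDiff_partialFst hV
  have hr1 := contDiff_partialFst hr
  have hγ1 := contDiff_partialFst hγ
  obtain ⟨L, hLe⟩ : ∃ L : ℝ × ℝ → ℝ, L = fun p =>
      r p * ⟪partialSnd T p, partialSnd T p⟫_ℝ + r p * ⟪partialSnd V p, B p⟫_ℝ ^ 2
      + partialSnd r p ^ 2 / r p := ⟨_, rfl⟩
  have hL : ContDiff ℝ ∞ L := by
    rw [hLe]
    exact ((hr.mul (hT'.inner ℝ hT')).add (hr.mul ((hV'.inner ℝ hB).pow 2))).add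
      ((hr'.pow 2).div hr hr0)
  have hE : (fun ε => energy (F ε).curve (F ε).frame) = fun ε => ∫ t in (0 : ℝ)..2, L (ε, t) := by
    funext ε
    rw [FramedLoop.energy_eq_integral]
    simp only [hTd, hVd, hBs, hrd, hrs, hLe]
  obtain ⟨e, he⟩ := h0.axis
  -- `U` collects the boundary terms. The term with `T'` comes from integrating the bending part by
  -- parts, where the remainder `k²⟨T, ∂_ε T⟩` vanishes. The term with `V` comes from the twist,
  -- whose remainder is `⟨T × T', ∂_ε T⟩ = ⟨e, ∂_ε T⟩`. As `e` is constant and orthogonal to `T`,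
  -- `(ℓ/2)⟨e, ∂_ε T⟩` is `∂_t ⟨e, ∂_ε γ⟩`, which gives the first term.
  obtain ⟨U, hUe⟩ : ∃ U : ℝ × ℝ → ℝ, U = fun p => 2 * τ * ⟪e, partialFst γ p⟫_ℝ
      + ℓ * ⟪partialSnd T p, partialFst T p⟫_ℝ + ℓ * τ * ⟪partialFst V p, B p⟫_ℝ := ⟨_, rfl⟩
  have hU : ContDiff ℝ ∞ U := by
    rw [hUe]
    exact ((contDiff_const.mul (contDiff_const.inner ℝ hγ1)).add
      (contDiff_const.mul (hT'.inner ℝ hT1))).add (contDiff_const.mul (hV1.inner ℝ hB))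
  have hr00 : ∀ t, r (0, t) = ℓ / 2 := fun t => by rw [← hrs, h0.speed]
  have hTT : ∀ p, ⟪T p, T p⟫_ℝ = 1 := fun p => by
    have := (F p.1).unitTangent_inner_self p.2
    rwa [hTs] at this
  have hVV : ∀ p, ⟪V p, V p⟫_ℝ = 1 := fun p => by
    have := (F p.1).frame_inner_self p.2
    rwa [hVs] at this
  have hTV : ∀ p, ⟪T p, V p⟫_ℝ = 0 := fun p => by
    have := (F p.1).unitTangent_inner_frame p.2
    rwa [hTs, hVs] at this
  have hTB : ∀ p, ⟪T p, B p⟫_ℝ = 0 := fun p => by rw [hBe]; exact inner_cross_left _ _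
  have hBB : ∀ p, ⟪B p, B p⟫_ℝ = 1 := fun p => by
    have := (F p.1).binormal_inner_self p.2
    rwa [hBs] at this
  have hself : ∀ {f : ℝ × ℝ → E3}, ContDiff ℝ ∞ f → (∀ p, ⟪f p, f p⟫_ℝ = 1) → ∀ p,
      ⟪partialFst f p, f p⟫_ℝ = 0 ∧ ⟪partialSnd f p, f p⟫_ℝ = 0 := by
    intro f hf h p
    have h1 := inner_partialFst_add hf hf h p
    have h2 := inner_partialSnd_add hf hf h p
    rw [real_inner_comm (partialFst f p)] at h1
    rw [real_inner_comm (partialSnd f p)] at h2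
    constructor <;> linarith
  have hdL : ∀ t, partialFst L (0, t)
      = (k ^ 2 + τ ^ 2) * partialFst r (0, t) + partialSnd U (0, t) := by
    intro t
    have a1 := ((hasDerivAt_partialFst hr 0 t).mul ((hasDerivAt_partialFst hT' 0 t).inner ℝ
      (hasDerivAt_partialFst hT' 0 t))).add ((hasDerivAt_partialFst hr 0 t).mul
      (((hasDerivAt_partialFst hV' 0 t).inner ℝ (hasDerivAt_partialFst hB 0 t)).pow 2)) |>.add
      (((hasDerivAt_partialFst hr' 0 t).pow 2).div (hasDerivAt_partialFst hr 0 t) (hr0 _))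
    have a2 := hasDerivAt_partialFst hL 0 t
    rw [hLe] at a2
    have a3 := a2.unique a1
    have b1 := (((hasDerivAt_const t e).inner ℝ (hasDerivAt_partialSnd hγ1 0 t)).const_mul
      (2 * τ)).add (((hasDerivAt_partialSnd hT' 0 t).inner ℝ
      (hasDerivAt_partialSnd hT1 0 t)).const_mul ℓ) |>.add
      (((hasDerivAt_partialSnd hV1 0 t).inner ℝ (hasDerivAt_partialSnd hB 0 t)).const_mul (ℓ * τ))
    have b2 := hasDerivAt_partialSnd hU 0 t
    rw [hUe] at b2
    have b3 := b2.unique b1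
    rw [← hLe] at a3
    rw [← hUe] at b3
    have c1 : partialSnd r (0, t) = 0 := by
      rw [← hrd]
      simp [hr00]
    have c2 : ⟪partialSnd T (0, t), partialSnd T (0, t)⟫_ℝ = k ^ 2 := by
      rw [← hTd]; exact h0.inner_deriv_tangent t
    have c3 : ⟪partialSnd V (0, t), B (0, t)⟫_ℝ = τ := by
      rw [← hVd, ← hBs]; exact h0.twist t
    have c4 : partialSnd (partialSnd T) (0, t) = -(k ^ 2) • T (0, t) := by
      have h := h0.tangent t
      rw [show deriv (unitTangent (F 0).curve) = fun t => partialSnd T (0, t) from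
        funext (hTd 0), hTs] at h
      rw [← h]
      exact (hasDerivAt_partialSnd hT' 0 t).deriv.symm
    have c5 : e = cross (T (0, t)) (partialSnd T (0, t)) := by
      rw [← he t, hTd, hTs]
    have c6 : partialSnd (partialFst γ) (0, t)
        = r (0, t) • partialFst T (0, t) + partialFst r (0, t) • T (0, t) := by
      rw [← partialFst_partialSnd hγ, ← hXe]
      have h := (hasDerivAt_partialFst hr 0 t).smul (hasDerivAt_partialFst hT 0 t)
      have h' : X = fun p => r p • T p := by
        funext p
        rw [hTe, smul_smul, mul_inv_cancel₀ (hr0 p), one_smul]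
      have h2 := hasDerivAt_partialFst hX 0 t
      exact h2.unique (by rw [h']; exact h)
    have c7 : ⟪e, T (0, t)⟫_ℝ = 0 := by
      rw [c5, real_inner_comm]; exact inner_cross_left _ _
    have c8 : ⟪T (0, t), partialFst T (0, t)⟫_ℝ = 0 := by
      rw [real_inner_comm]; exact (hself hT hTT _).1
    -- The curvature-type term left over when `∂_ε` and `∂_t` are exchanged in the twist.
    have c9 : ⟪partialSnd V (0, t), partialFst B (0, t)⟫_ℝ
        - ⟪partialFst V (0, t), partialSnd B (0, t)⟫_ℝ = ⟪e, partialFst T (0, t)⟫_ℝ := by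
      have hBp : B (0, t) = cross (T (0, t)) (V (0, t)) := by rw [hBe]
      rw [c5]
      refine inner_variation_sub (hTT _) (hVV _) (hTV _) (hself hV hVV _).1 (hself hV hVV _).2
        ?_ ?_ (inner_partialFst_add hT hV hTV _) (inner_partialSnd_add hT hV hTV _) ?_ ?_ <;>
        rw [← hBp]
      · exact (hself hB hBB _).1
      · exact (hself hB hBB _).2
      · exact inner_partialFst_add hT hB hTB _
      · exact inner_partialSnd_add hT hB hTB _
    rw [a3, b3, ← partialFst_partialSnd hT, ← partialFst_partialSnd hV, c4, c6]
    simp only [inner_add_right, real_inner_smul_left, real_inner_smul_right, inner_zero_left, Pi.pow_apply]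
    rw [c1, c2, c3, c7, c8, hr00, real_inner_comm (partialSnd T (0, t))]
    simp
    linear_combination ℓ * τ * c9
  have hint := hasDerivAt_integral_of_contDiff hL 0 2 0
  rw [hE]
  convert hint using 1
  have hlen : ∫ t in (0 : ℝ)..2, partialFst r (0, t) = 0 := by
    have h1 := hasDerivAt_integral_of_contDiff hr 0 2 0
    have h2 : (fun ε => ∫ t in (0 : ℝ)..2, r (ε, t)) = fun _ => ℓ := by
      funext ε
      rw [← (F ε).length_eq, length]
      simp only [hrs]
    rw [h2] at h1
    exact h1.unique (hasDerivAt_const _ _)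
  have hperF : ∀ {f : ℝ × ℝ → E3}, ContDiff ℝ ∞ f → (∀ e t, f (e, t + 2) = f (e, t)) →
      ∀ e t, partialFst f (e, t + 2) = partialFst f (e, t) := by
    intro f hf h e t
    have h1 := hasDerivAt_partialFst hf e (t + 2)
    simp only [h] at h1
    exact h1.unique (hasDerivAt_partialFst hf e t)
  have hperS : ∀ {f : ℝ × ℝ → E3}, ContDiff ℝ ∞ f → (∀ e t, f (e, t + 2) = f (e, t)) →
      ∀ e t, partialSnd f (e, t + 2) = partialSnd f (e, t) := by
    intro f hf h e t
    have h1 := (hasDerivAt_partialSnd hf e (t + 2)).comp_add_const t 2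
    simp only [h] at h1
    exact h1.unique (hasDerivAt_partialSnd hf e t)
  have pγ : ∀ e t, γ (e, t + 2) = γ (e, t) := fun e t => by
    rw [← hγs, ← hγs]; exact (F e).periodic_curve t
  have pV : ∀ e t, V (e, t + 2) = V (e, t) := fun e t => by
    rw [← hVs, ← hVs]; exact (F e).periodic_frame t
  have pT : ∀ e t, T (e, t + 2) = T (e, t) := fun e t => by
    have := (F e).periodic_unitTangent t
    rwa [hTs] at this
  have pB : ∀ e t, B (e, t + 2) = B (e, t) := fun e t => by
    rw [← hBs, ← hBs]; exact (F e).periodic_binormal t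
  have hUp : Function.Periodic (fun t => U (0, t)) 2 := by
    intro t
    simp only [hUe, hperF hγ pγ, hperF hT pT, hperF hV pV, hperS hT pT, pB]
  have c1 : Continuous fun t => partialFst r (0, t) := hr1.continuous.comp (by fun_prop)
  have c2 : Continuous fun t => partialSnd U (0, t) :=
    (contDiff_partialSnd hU).continuous.comp (by fun_prop)
  simp only [hdL]
  rw [intervalIntegral.integral_add ((c1.const_mul _).intervalIntegrable _ _)
    (c2.intervalIntegrable _ _), intervalIntegral.integral_const_mul, hlen,
    integral_partialSnd_eq_zero hU 0 hUp]
  simp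

/-! ### Existence of twisted circles -/

theorem hasDerivAt_vec3 {f g h : ℝ → ℝ} {f' g' h' t : ℝ} (hf : HasDerivAt f f' t)
    (hg : HasDerivAt g g' t) (hh : HasDerivAt h h' t) :
    HasDerivAt (fun t => (!₂[f t, g t, h t] : E3)) !₂[f', g', h'] t := by
  have h1 : HasDerivAt (fun t => ![f t, g t, h t]) ![f', g', h'] t := by
    rw [hasDerivAt_pi]
    intro i
    fin_cases i
    exacts [hf, hg, hh]
  exact ((EuclideanSpace.equiv (Fin 3) ℝ).symm : (Fin 3 → ℝ) →L[ℝ] E3).hasFDerivAt.comp_hasDerivAt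
    t h1

theorem contDiff_vec3 {G : Type*} [NormedAddCommGroup G] [NormedSpace ℝ G] {f g h : G → ℝ}
    (hf : ContDiff ℝ ∞ f) (hg : ContDiff ℝ ∞ g) (hh : ContDiff ℝ ∞ h) :
    ContDiff ℝ ∞ (fun t => (!₂[f t, g t, h t] : E3)) := by
  refine contDiff_euclidean.2 fun i => ?_
  fin_cases i
  exacts [hf, hg, hh]

theorem vec3_congr {a b c a' b' c' : ℝ} (ha : a = a') (hb : b = b') (hc : c = c') :
    (!₂[a, b, c] : E3) = !₂[a', b', c'] := by
  rw [ha, hb, hc]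

theorem norm_vec3 (a b c : ℝ) : ‖(!₂[a, b, c] : E3)‖ = √(a ^ 2 + b ^ 2 + c ^ 2) := by
  simp [EuclideanSpace.norm_eq, Fin.sum_univ_three]

theorem cross_vec3 (a b c x y z : ℝ) :
    cross !₂[a, b, c] !₂[x, y, z] = !₂[b * z - c * y, c * x - a * z, a * y - b * x] := by
  ext i
  fin_cases i <;> simp [cross, crossProduct]

theorem inner_vec3 (a b c x y z : ℝ) :
    ⟪(!₂[a, b, c] : E3), !₂[x, y, z]⟫_ℝ = a * x + b * y + c * z := by
  rw [inner_eq_sum]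
  simp

theorem smul_vec3 (r a b c : ℝ) : r • (!₂[a, b, c] : E3) = !₂[r * a, r * b, r * c] := by
  ext i
  fin_cases i <;> simp

theorem hasDerivAt_cos_mul (w t : ℝ) :
    HasDerivAt (fun t => Real.cos (w * t)) (-(w * Real.sin (w * t))) t := by
  have := ((hasDerivAt_id t).const_mul w).cos
  simpa [mul_comm] using this

theorem hasDerivAt_sin_mul (w t : ℝ) :
    HasDerivAt (fun t => Real.sin (w * t)) (w * Real.cos (w * t)) t := by
  have := ((hasDerivAt_id t).const_mul w).sin
  simpa [mul_comm] using this

theorem periodic_cos_int_mul_pi (m : ℤ) :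
    Function.Periodic (fun t => Real.cos ((m : ℝ) * Real.pi * t)) 2 := by
  intro t
  simp only
  rw [← Real.cos_add_int_mul_two_pi (m * Real.pi * t) m]
  congr 1
  ring

theorem periodic_sin_int_mul_pi (m : ℤ) :
    Function.Periodic (fun t => Real.sin ((m : ℝ) * Real.pi * t)) 2 := by
  intro t
  simp only
  rw [← Real.sin_add_int_mul_two_pi (m * Real.pi * t) m]
  congr 1
  ring

theorem contDiff_cos_mul (w : ℝ) : ContDiff ℝ ∞ fun t => Real.cos (w * t) :=
  Real.contDiff_cos.comp (contDiff_const.mul contDiff_id)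

theorem contDiff_sin_mul (w : ℝ) : ContDiff ℝ ∞ fun t => Real.sin (w * t) :=
  Real.contDiff_sin.comp (contDiff_const.mul contDiff_id)

/-- The parameter period is `2`, so the angular rates `mπ` and `nπ` are those that close up with
period `2`; `m = 0` would give no closed curve. -/
theorem exists_isTwistedCircle {ℓ : ℝ} (hℓ : 0 < ℓ) {m : ℤ} (hm : m ≠ 0) (n : ℤ) :
    ∃ x : FramedLoop ℓ, IsTwistedCircle x (m * Real.pi) (n * Real.pi) := by
  have hw : (m : ℝ) * Real.pi ≠ 0 := mul_ne_zero (by exact_mod_cast hm) Real.pi_ne_zero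
  have pc := periodic_cos_int_mul_pi m
  have ps := periodic_sin_int_mul_pi m
  have qc := periodic_cos_int_mul_pi n
  have qs := periodic_sin_int_mul_pi n
  obtain ⟨w, hwe⟩ : ∃ w, w = (m : ℝ) * Real.pi := ⟨_, rfl⟩
  obtain ⟨v, hve⟩ : ∃ v, v = (n : ℝ) * Real.pi := ⟨_, rfl⟩
  rw [← hwe] at hw pc ps ⊢
  rw [← hve] at qc qs ⊢
  -- The signed radius `ℓ / (2w)` makes the speed `ℓ / 2`. Below, `V` is the planar normal `(-sin
  -- wt, cos wt, 0)` turned by the angle `vt` towards the third axis.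
  obtain ⟨γ, hγ⟩ : ∃ γ : ℝ → E3, γ = fun t =>
    !₂[ℓ / 2 / w * Real.sin (w * t), -(ℓ / 2 / w * Real.cos (w * t)), 0] := ⟨_, rfl⟩
  obtain ⟨V, hV⟩ : ∃ V : ℝ → E3, V = fun t =>
    !₂[-(Real.cos (v * t) * Real.sin (w * t)), Real.cos (v * t) * Real.cos (w * t),
      Real.sin (v * t)] := ⟨_, rfl⟩
  have hγ' : ∀ t, deriv γ t = !₂[ℓ / 2 * Real.cos (w * t), ℓ / 2 * Real.sin (w * t), 0] := by
    intro t
    have h := hasDerivAt_vec3 ((hasDerivAt_sin_mul w t).const_mul (ℓ / 2 / w))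
      ((hasDerivAt_cos_mul w t).const_mul (ℓ / 2 / w)).fun_neg (hasDerivAt_const t (0 : ℝ))
    rw [hγ, h.deriv]
    refine vec3_congr ?_ ?_ rfl <;> field_simp
  have hs : ∀ t, ‖deriv γ t‖ = ℓ / 2 := by
    intro t
    rw [hγ', norm_vec3, Real.sqrt_eq_iff_eq_sq (by positivity) (by positivity)]
    linear_combination (ℓ / 2) ^ 2 * Real.sin_sq_add_cos_sq (w * t)
  have hT : unitTangent γ = fun t => !₂[Real.cos (w * t), Real.sin (w * t), 0] := by
    funext t
    rw [unitTangent, arcDeriv, hs, hγ', smul_vec3]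
    exact vec3_congr (by field_simp) (by field_simp) (mul_zero _)
  have hT' : deriv (unitTangent γ) =
      fun t => !₂[-(w * Real.sin (w * t)), w * Real.cos (w * t), 0] := by
    funext t
    rw [hT]
    exact (hasDerivAt_vec3 (hasDerivAt_cos_mul w t) (hasDerivAt_sin_mul w t)
      (hasDerivAt_const t (0 : ℝ))).deriv
  refine ⟨⟨γ, V, ?_, ?_, ?_, ?_, ?_, ?_, ?_, ?_⟩, ?_, ?_, ?_, ?_⟩
  · rw [hγ]
    exact contDiff_vec3 (contDiff_const.mul (contDiff_sin_mul w))
      (contDiff_const.mul (contDiff_cos_mul w)).neg contDiff_const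
  · rw [hV]
    exact contDiff_vec3 ((contDiff_cos_mul v).mul (contDiff_sin_mul w)).neg
      ((contDiff_cos_mul v).mul (contDiff_cos_mul w)) (contDiff_sin_mul v)
  · intro t
    have h1 := pc t
    have h2 := ps t
    simp only at h1 h2
    simp only [hγ, h1, h2]
  · intro t
    have h1 := pc t
    have h2 := ps t
    have h3 := qc t
    have h4 := qs t
    simp only at h1 h2 h3 h4
    simp only [hV, h1, h2, h3, h4]
  · intro t
    rw [← norm_ne_zero_iff, hs]
    positivity
  · intro t
    rw [hV, norm_vec3, Real.sqrt_eq_one]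
    linear_combination Real.cos (v * t) ^ 2 * Real.sin_sq_add_cos_sq (w * t)
      + Real.sin_sq_add_cos_sq (v * t)
  · intro t
    rw [hγ', hV, inner_vec3]
    ring
  · simp [length, hs]
  · exact hs
  · intro t
    change deriv (deriv (unitTangent γ)) t = _ • unitTangent γ t
    rw [hT', hT, (hasDerivAt_vec3 ((hasDerivAt_sin_mul w t).const_mul w).fun_neg
      ((hasDerivAt_cos_mul w t).const_mul w) (hasDerivAt_const t (0 : ℝ))).deriv, smul_vec3]
    exact vec3_congr (by ring) (by ring) (by ring)
  · refine ⟨!₂[0, 0, w], fun t => ?_⟩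
    change cross (unitTangent γ t) (deriv (unitTangent γ) t) = _
    rw [hT', hT, cross_vec3]
    exact vec3_congr (by ring) (by ring)
      (by linear_combination w * Real.sin_sq_add_cos_sq (w * t))
  · intro t
    change ⟪deriv V t, cross (unitTangent γ t) (V t)⟫_ℝ = _
    have h := hasDerivAt_vec3
      ((hasDerivAt_cos_mul v t).fun_mul (hasDerivAt_sin_mul w t)).fun_neg
      ((hasDerivAt_cos_mul v t).fun_mul (hasDerivAt_cos_mul w t)) (hasDerivAt_sin_mul v t)
    rw [hT, hV, h.deriv, cross_vec3, inner_vec3]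
    linear_combination
      (v * Real.sin (v * t) ^ 2 + v * Real.cos (v * t) ^ 2) * Real.sin_sq_add_cos_sq (w * t)
      + v * Real.sin_sq_add_cos_sq (v * t)

/-- The energies of twisted circles are critical energy levels. -/
theorem IsTwistedCircle.mem_criticalEnergyLevels {ℓ k τ : ℝ} {x : FramedLoop ℓ}
    (hx : IsTwistedCircle x k τ) : ℓ * (k ^ 2 + τ ^ 2) ∈ criticalEnergyLevels ℓ := by
  refine ⟨x.toModuli, fun F hF h0 => ?_, hx.energy_eq⟩
  have hc : Congruent (F 0) x := Quotient.exact (s := congruenceSetoid ℓ) h0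
  exact (hx.congr hc.symm).hasDerivAt_energy hF

/-- With `m = (d - c)/2` and `n = (d + c)/2` one has `c² + d² = 2(m² + n²)`. -/
theorem mem_criticalEnergyLevels {ℓ : ℝ} (hℓ : 0 < ℓ) {c d : ℤ} (hcd : c ≡ d [ZMOD 2])
    (h0 : ¬(c = 0 ∧ d = 0)) :
    ℓ * (Real.pi ^ 2 * ((c : ℝ) ^ 2 + (d : ℝ) ^ 2) / 2) ∈ criticalEnergyLevels ℓ := by
  obtain ⟨p, hp⟩ : ∃ p, d = c + 2 * p := ⟨(d - c) / 2, by have := hcd.dvd; omega⟩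
  have key : ∀ m n : ℤ, m ≠ 0 → (c : ℝ) ^ 2 + (d : ℝ) ^ 2 = 2 * ((m : ℝ) ^ 2 + (n : ℝ) ^ 2) →
      ℓ * (Real.pi ^ 2 * ((c : ℝ) ^ 2 + (d : ℝ) ^ 2) / 2) ∈ criticalEnergyLevels ℓ := by
    intro m n hm h
    obtain ⟨x, hx⟩ := exists_isTwistedCircle hℓ hm n
    convert hx.mem_criticalEnergyLevels using 1
    rw [h]
    ring
  -- If `c = d`, the choice `m = p = 0` is not allowed; the untwisted circle covered `c ≠ 0` times
  -- has the same energy.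
  by_cases hp0 : p = 0
  · refine key c 0 (by omega) ?_
    rw [hp, hp0]
    push_cast
    ring
  · refine key p (c + p) hp0 ?_
    rw [hp]
    push_cast
    ring

/-! ### Spinors -/

/-- The squared norm of the spinor `(a, b)`. -/
def spinSpeed (a b : ℂ) : ℝ := a.re ^ 2 + a.im ^ 2 + b.re ^ 2 + b.im ^ 2

/-- The tangent vector `(|a|² - |b|², 2 Re (a̅ b), 2 Im (a̅ b))` of the spinor `(a, b)`. -/
def spinTangent (a b : ℂ) : E3 :=
  !₂[a.re ^ 2 + a.im ^ 2 - b.re ^ 2 - b.im ^ 2, 2 * (a.re * b.re + a.im * b.im),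
    2 * (a.re * b.im - a.im * b.re)]

/-- The real part of the isotropic vector `(-2ab, a² - b², i(a² + b²))`. -/
def spinNormal (a b : ℂ) : E3 :=
  !₂[-2 * (a.re * b.re - a.im * b.im), a.re ^ 2 - a.im ^ 2 - b.re ^ 2 + b.im ^ 2,
    -2 * (a.re * a.im + b.re * b.im)]

/-- The imaginary part of the isotropic vector `(-2ab, a² - b², i(a² + b²))`. -/
def spinBinormal (a b : ℂ) : E3 :=
  !₂[-2 * (a.re * b.im + a.im * b.re), 2 * (a.re * a.im - b.re * b.im),
    a.re ^ 2 - a.im ^ 2 + b.re ^ 2 - b.im ^ 2]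

theorem spinSpeed_nonneg (a b : ℂ) : 0 ≤ spinSpeed a b := by
  unfold spinSpeed; positivity

theorem spinSpeed_eq (a b : ℂ) : spinSpeed a b = Complex.normSq a + Complex.normSq b := by
  rw [spinSpeed, Complex.normSq_apply, Complex.normSq_apply]; ring

theorem inner_spinTangent_self (a b : ℂ) :
    ⟪spinTangent a b, spinTangent a b⟫_ℝ = spinSpeed a b ^ 2 := by
  simp only [spinTangent, spinSpeed, inner_vec3]; ring

theorem inner_spinNormal_self (a b : ℂ) :
    ⟪spinNormal a b, spinNormal a b⟫_ℝ = spinSpeed a b ^ 2 := by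
  simp only [spinNormal, spinSpeed, inner_vec3]; ring

theorem inner_spinTangent_spinNormal (a b : ℂ) :
    ⟪spinTangent a b, spinNormal a b⟫_ℝ = 0 := by
  simp only [spinTangent, spinNormal, inner_vec3]; ring

theorem inner_spinNormal_spinBinormal (a b : ℂ) :
    ⟪spinNormal a b, spinBinormal a b⟫_ℝ = 0 := by
  simp only [spinBinormal, spinNormal, inner_vec3]; ring

theorem cross_spinTangent_spinNormal (a b : ℂ) :
    cross (spinTangent a b) (spinNormal a b) = spinSpeed a b • spinBinormal a b := by
  simp only [spinTangent, spinNormal, spinBinormal, spinSpeed, cross_vec3, smul_vec3]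
  exact vec3_congr (by ring) (by ring) (by ring)

theorem norm_spinTangent (a b : ℂ) : ‖spinTangent a b‖ = spinSpeed a b := by
  have h := inner_spinTangent_self a b
  rw [real_inner_self_eq_norm_sq] at h
  exact (sq_eq_sq₀ (norm_nonneg _) (spinSpeed_nonneg a b)).1 h

theorem norm_spinNormal (a b : ℂ) : ‖spinNormal a b‖ = spinSpeed a b := by
  have h := inner_spinNormal_self a b
  rw [real_inner_self_eq_norm_sq] at h
  exact (sq_eq_sq₀ (norm_nonneg _) (spinSpeed_nonneg a b)).1 h

/-- The functions `a, b` form a spinor field inducing the framed loop `x`. -/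
structure IsSpinor {ℓ : ℝ} (x : FramedLoop ℓ) (a b : ℝ → ℂ) : Prop where
  smooth_fst : ContDiff ℝ ∞ a
  smooth_snd : ContDiff ℝ ∞ b
  tangent : ∀ t, deriv x.curve t = spinTangent (a t) (b t)
  frame : ∀ t, spinSpeed (a t) (b t) • x.frame t = spinNormal (a t) (b t)

theorem hasDerivAt_re {a : ℝ → ℂ} {a' : ℂ} {t : ℝ} (h : HasDerivAt a a' t) :
    HasDerivAt (fun t => (a t).re) a'.re t :=
  Complex.reCLM.hasFDerivAt.comp_hasDerivAt t h

theorem hasDerivAt_im {a : ℝ → ℂ} {a' : ℂ} {t : ℝ} (h : HasDerivAt a a' t) :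
    HasDerivAt (fun t => (a t).im) a'.im t :=
  Complex.imCLM.hasFDerivAt.comp_hasDerivAt t h

theorem contDiff_re {G : Type*} [NormedAddCommGroup G] [NormedSpace ℝ G] {a : G → ℂ}
    (h : ContDiff ℝ ∞ a) : ContDiff ℝ ∞ fun t => (a t).re :=
  Complex.reCLM.contDiff.comp h

theorem contDiff_im {G : Type*} [NormedAddCommGroup G] [NormedSpace ℝ G] {a : G → ℂ}
    (h : ContDiff ℝ ∞ a) : ContDiff ℝ ∞ fun t => (a t).im :=
  Complex.imCLM.contDiff.comp h

section Smooth

variable {G : Type*} [NormedAddCommGroup G] [NormedSpace ℝ G] {a b : G → ℂ}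

theorem contDiff_spinSpeed (ha : ContDiff ℝ ∞ a) (hb : ContDiff ℝ ∞ b) :
    ContDiff ℝ ∞ fun t => spinSpeed (a t) (b t) :=
  ((((contDiff_re ha).pow 2).add ((contDiff_im ha).pow 2)).add ((contDiff_re hb).pow 2)).add
    ((contDiff_im hb).pow 2)

theorem contDiff_spinTangent (ha : ContDiff ℝ ∞ a) (hb : ContDiff ℝ ∞ b) :
    ContDiff ℝ ∞ fun t => spinTangent (a t) (b t) := by
  have a1 := contDiff_re ha
  have a2 := contDiff_im ha
  have b1 := contDiff_re hb
  have b2 := contDiff_im hb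
  exact contDiff_vec3 ((((a1.pow 2).add (a2.pow 2)).sub (b1.pow 2)).sub (b2.pow 2))
    (contDiff_const.mul ((a1.mul b1).add (a2.mul b2)))
    (contDiff_const.mul ((a1.mul b2).sub (a2.mul b1)))

theorem contDiff_spinNormal (ha : ContDiff ℝ ∞ a) (hb : ContDiff ℝ ∞ b) :
    ContDiff ℝ ∞ fun t => spinNormal (a t) (b t) := by
  have a1 := contDiff_re ha
  have a2 := contDiff_im ha
  have b1 := contDiff_re hb
  have b2 := contDiff_im hb
  exact contDiff_vec3 (contDiff_const.mul ((a1.mul b1).sub (a2.mul b2)))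
    ((((a1.pow 2).sub (a2.pow 2)).sub (b1.pow 2)).add (b2.pow 2))
    (contDiff_const.mul ((a1.mul a2).add (b1.mul b2)))

end Smooth

section Derivatives

variable {a b : ℝ → ℂ} {a' b' : ℂ} {t : ℝ}

theorem hasDerivAt_spinSpeed (ha : HasDerivAt a a' t) (hb : HasDerivAt b b' t) :
    HasDerivAt (fun t => spinSpeed (a t) (b t))
      (2 * ((a t).re * a'.re + (a t).im * a'.im + (b t).re * b'.re + (b t).im * b'.im)) t := by
  have h := ((((hasDerivAt_re ha).fun_pow 2).fun_add ((hasDerivAt_im ha).fun_pow 2)).fun_add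
    ((hasDerivAt_re hb).fun_pow 2)).fun_add ((hasDerivAt_im hb).fun_pow 2)
  exact h.congr_deriv (by push_cast; ring)

theorem hasDerivAt_spinTangent (ha : HasDerivAt a a' t) (hb : HasDerivAt b b' t) :
    HasDerivAt (fun t => spinTangent (a t) (b t))
      !₂[2 * ((a t).re * a'.re + (a t).im * a'.im - (b t).re * b'.re - (b t).im * b'.im),
        2 * (a'.re * (b t).re + (a t).re * b'.re + a'.im * (b t).im + (a t).im * b'.im),
        2 * (a'.re * (b t).im + (a t).re * b'.im - a'.im * (b t).re - (a t).im * b'.re)] t := by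
  have a1 := hasDerivAt_re ha
  have a2 := hasDerivAt_im ha
  have b1 := hasDerivAt_re hb
  have b2 := hasDerivAt_im hb
  have h := hasDerivAt_vec3
    ((((a1.fun_pow 2).fun_add (a2.fun_pow 2)).fun_sub (b1.fun_pow 2)).fun_sub (b2.fun_pow 2))
    (((a1.fun_mul b1).fun_add (a2.fun_mul b2)).const_mul 2)
    (((a1.fun_mul b2).fun_sub (a2.fun_mul b1)).const_mul 2)
  refine h.congr_deriv ?_
  exact vec3_congr (by push_cast; ring) (by ring) (by ring)

theorem hasDerivAt_spinNormal (ha : HasDerivAt a a' t) (hb : HasDerivAt b b' t) :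
    HasDerivAt (fun t => spinNormal (a t) (b t))
      !₂[-2 * (a'.re * (b t).re + (a t).re * b'.re - a'.im * (b t).im - (a t).im * b'.im),
        2 * ((a t).re * a'.re - (a t).im * a'.im - (b t).re * b'.re + (b t).im * b'.im),
        -2 * (a'.re * (a t).im + (a t).re * a'.im + b'.re * (b t).im + (b t).re * b'.im)] t := by
  have a1 := hasDerivAt_re ha
  have a2 := hasDerivAt_im ha
  have b1 := hasDerivAt_re hb
  have b2 := hasDerivAt_im hb
  have h := hasDerivAt_vec3 (((a1.fun_mul b1).fun_sub (a2.fun_mul b2)).const_mul (-2))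
    ((((a1.fun_pow 2).fun_sub (a2.fun_pow 2)).fun_sub (b1.fun_pow 2)).fun_add (b2.fun_pow 2))
    (((a1.fun_mul a2).fun_add (b1.fun_mul b2)).const_mul (-2))
  refine h.congr_deriv ?_
  exact vec3_congr (by ring) (by push_cast; ring) (by ring)

end Derivatives

namespace IsSpinor

variable {ℓ : ℝ} {x : FramedLoop ℓ} {a b : ℝ → ℂ}

theorem speed (h : IsSpinor x a b) (t : ℝ) : ‖deriv x.curve t‖ = spinSpeed (a t) (b t) := by
  rw [h.tangent, norm_spinTangent]

theorem speed_pos (h : IsSpinor x a b) (t : ℝ) : 0 < spinSpeed (a t) (b t) :=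
  h.speed t ▸ x.speed_pos t

theorem frame_eq (h : IsSpinor x a b) (t : ℝ) :
    x.frame t = (spinSpeed (a t) (b t))⁻¹ • spinNormal (a t) (b t) := by
  rw [← h.frame, inv_smul_smul₀ (h.speed_pos t).ne']

theorem unitTangent_eq (h : IsSpinor x a b) (t : ℝ) :
    unitTangent x.curve t = (spinSpeed (a t) (b t))⁻¹ • spinTangent (a t) (b t) := by
  rw [unitTangent, arcDeriv, h.speed, h.tangent]

theorem binormal_eq (h : IsSpinor x a b) (t : ℝ) :
    x.binormal t = (spinSpeed (a t) (b t))⁻¹ • spinBinormal (a t) (b t) := by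
  have hr := (h.speed_pos t).ne'
  have hc : ∀ (r s : ℝ) (p q : E3), cross (r • p) (s • q) = (r * s) • cross p q := by
    intro r s p q
    simp [cross, smul_smul, mul_comm]
  rw [FramedLoop.binormal, h.unitTangent_eq, h.frame_eq, hc, cross_spinTangent_spinNormal,
    smul_smul]
  congr 1
  field_simp

theorem differentiable_fst (h : IsSpinor x a b) : Differentiable ℝ a :=
  h.smooth_fst.differentiable (by simp)

theorem differentiable_snd (h : IsSpinor x a b) : Differentiable ℝ b :=
  h.smooth_snd.differentiable (by simp)

/-- The energy of a framed loop is four times the Dirichlet energy of its spinor field. -/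
theorem energy_eq (h : IsSpinor x a b) :
    energy x.curve x.frame = ∫ t in (0 : ℝ)..2,
      4 * (Complex.normSq (deriv a t) + Complex.normSq (deriv b t)) := by
  rw [x.energy_eq_integral]
  refine intervalIntegral.integral_congr fun t _ => ?_
  have ha := (h.differentiable_fst t).hasDerivAt
  have hb := (h.differentiable_snd t).hasDerivAt
  have hr := (h.speed_pos t).ne'
  have dr := hasDerivAt_spinSpeed ha hb
  obtain ⟨X', hX', dX⟩ : ∃ X', X' = _ ∧ HasDerivAt _ X' t := ⟨_, rfl, hasDerivAt_spinTangent ha hb⟩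
  obtain ⟨N', hN', dN⟩ : ∃ N', N' = _ ∧ HasDerivAt _ N' t := ⟨_, rfl, hasDerivAt_spinNormal ha hb⟩
  have dT := (dr.fun_inv hr).fun_smul dX
  have dV := (dr.fun_inv hr).fun_smul dN
  simp only [← funext h.unitTangent_eq] at dT
  simp only [← funext h.frame_eq] at dV
  obtain ⟨ρ, hρ⟩ : ∃ ρ, ρ = (a t).re * (deriv a t).re + (a t).im * (deriv a t).im
    + (b t).re * (deriv b t).re + (b t).im * (deriv b t).im := ⟨_, rfl⟩
  -- `ρ` and `μ` are the real and imaginary parts of the Hermitian product of `(a, b)` with `(a',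
  -- b')`. The tangential derivative loses `4ρ²` and `4μ²` compared with the full Dirichlet density;
  -- the stretch term restores the former and the twist term the latter.
  obtain ⟨μ, hμ⟩ : ∃ μ, μ = (a t).re * (deriv a t).im - (a t).im * (deriv a t).re
    + (b t).re * (deriv b t).im - (b t).im * (deriv b t).re := ⟨_, rfl⟩
  have e1 : ⟪spinTangent (a t) (b t), X'⟫_ℝ = 2 * spinSpeed (a t) (b t) * ρ := by
    simp only [hX', hρ, spinTangent, spinSpeed, inner_vec3]; ring
  have e1' := (real_inner_comm (spinTangent (a t) (b t)) X').trans e1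
  have e2 : ⟪X', X'⟫_ℝ = 4 * spinSpeed (a t) (b t)
      * (Complex.normSq (deriv a t) + Complex.normSq (deriv b t)) - 4 * μ ^ 2 := by
    simp only [hX', hμ, spinSpeed, inner_vec3, Complex.normSq_apply]; ring
  have e3 : ⟪N', spinBinormal (a t) (b t)⟫_ℝ = -2 * spinSpeed (a t) (b t) * μ := by
    simp only [hN', hμ, spinBinormal, spinSpeed, inner_vec3]; ring
  simp only [h.speed]
  rw [dT.deriv, dV.deriv, dr.deriv, h.binormal_eq, ← hρ]
  simp only [inner_add_left, inner_add_right, real_inner_smul_left, real_inner_smul_right,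
    inner_spinTangent_self, inner_spinNormal_spinBinormal, e1, e1', e2, e3]
  field_simp
  ring

end IsSpinor

/-! ### Lifting framed loops to spinor fields -/

/-- Two quadratic equations determine a spinor of a given orthonormal frame. -/
theorem spin_eq_of_mul_eq {r : ℝ} {T V : E3} {a b : ℂ} (hr : 0 < r) (hT : ⟪T, T⟫_ℝ = 1)
    (hV : ⟪V, V⟫_ℝ = 1) (hTV : ⟪T, V⟫_ℝ = 0) (hT0 : T 0 ≠ -1)
    (ha : a * a = ⟨r / 2 * (V 1 + cross T V 2), r / 2 * (cross T V 1 - V 2)⟩)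
    (hab : a * b = ⟨-(r / 2 * V 0), -(r / 2 * cross T V 0)⟩) :
    spinTangent a b = r • T ∧ spinNormal a b = r • V := by
  have hc := frame_completeness hT hV hTV
  have q00 := hc 0 0
  have q01 := hc 0 1
  have q02 := hc 0 2
  have q11 := hc 1 1
  have q12 := hc 1 2
  have q22 := hc 2 2
  have hTc := cross_frame_binormal hV hTV
  have t0 := congrArg (fun v : E3 => v 0) hTc
  have t1 := congrArg (fun v : E3 => v 1) hTc
  have t2 := congrArg (fun v : E3 => v 2) hTc
  simp only [if_true, Fin.reduceEq, if_false] at q00 q01 q02 q11 q12 q22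
  simp only [cross_apply_zero V, cross_apply_one V, cross_apply_two V] at t0 t1 t2
  have hB : ⟪cross T V, cross T V⟫_ℝ = 1 := by
    rw [inner_cross_cross, hT, hV, hTV]; norm_num
  have hVB := inner_cross_right T V
  rw [inner_eq_sum] at hT hV hB hVB
  generalize cross T V = B at *
  have u1 := congrArg Complex.re ha
  have u2 := congrArg Complex.im ha
  have w1 := congrArg Complex.re hab
  have w2 := congrArg Complex.im hab
  simp only [Complex.mul_re, Complex.mul_im] at u1 u2 w1 w2
  have hT1 : 0 < 1 + T 0 := by
    have h1 : -1 ≤ T 0 := by nlinarith [sq_nonneg (T 1), sq_nonneg (T 2)]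
    have := lt_of_le_of_ne h1 (Ne.symm hT0)
    linarith
  obtain ⟨p, hp⟩ : ∃ p, p = a.re ^ 2 + a.im ^ 2 := ⟨_, rfl⟩
  -- `p = |a|²`, and `|a²|²` is known from the first equation; it equals `(r/2)²(1 + T 0)²`.
  have hpp : p = r / 2 * (1 + T 0) := by
    have h1 : p ^ 2 = (r / 2 * (1 + T 0)) ^ 2 := by
      have : p ^ 2 = (a.re * a.re - a.im * a.im) ^ 2 + (a.re * a.im + a.im * a.re) ^ 2 := by
        rw [hp]; ring
      rw [this, u1, u2]
      linear_combination r ^ 2 / 4 * (q11 + q22 - hT + 2 * t0)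
    have h2 : 0 ≤ p := by rw [hp]; positivity
    exact (sq_eq_sq₀ h2 (by positivity)).1 h1
  have hp0 : p ≠ 0 := by rw [hpp]; positivity
  have hq : b.re ^ 2 + b.im ^ 2 = r / 2 * (1 - T 0) := by
    apply mul_left_cancel₀ hp0
    have : p * (b.re ^ 2 + b.im ^ 2)
        = (a.re * b.re - a.im * b.im) ^ 2 + (a.re * b.im + a.im * b.re) ^ 2 := by
      rw [hp]; ring
    rw [this, w1, w2, hpp]
    linear_combination r ^ 2 / 4 * q00
  -- Multiplication by `|a|²` expresses `a̅ b` through the known products: `|a|² a̅ b = conj(a²)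
  -- (ab)`. Likewise `b²` is found below from `a² b² = (ab)²`.
  have hz1 : a.re * b.re + a.im * b.im = r / 2 * T 1 := by
    apply mul_left_cancel₀ hp0
    have : p * (a.re * b.re + a.im * b.im)
        = (a.re * b.re - a.im * b.im) * (a.re * a.re - a.im * a.im)
          + (a.re * b.im + a.im * b.re) * (a.re * a.im + a.im * a.re) := by
      rw [hp]; ring
    rw [this, w1, w2, u1, u2, hpp]
    linear_combination r ^ 2 / 4 * (t1 - q01)
  have hz2 : a.re * b.im - a.im * b.re = r / 2 * T 2 := by
    apply mul_left_cancel₀ hp0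
    have : p * (a.re * b.im - a.im * b.re)
        = (a.re * b.im + a.im * b.re) * (a.re * a.re - a.im * a.im)
          - (a.re * b.re - a.im * b.im) * (a.re * a.im + a.im * a.re) := by
      rw [hp]; ring
    rw [this, w1, w2, u1, u2, hpp]
    linear_combination r ^ 2 / 4 * (t2 - q02)
  have ha0 : a ≠ 0 := by
    rintro rfl
    simp at hp
    exact hp0 hp
  have hb : b * b = ⟨r / 2 * (B 2 - V 1), -(r / 2 * (B 1 + V 2))⟩ := by
    apply mul_left_cancel₀ (mul_ne_zero ha0 ha0)
    have : a * a * (b * b) = (a * b) * (a * b) := by ring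
    rw [this, hab, ha]
    apply Complex.ext
    · simp only [Complex.mul_re]
      linear_combination r ^ 2 / 4 * (hV - hB)
    · simp only [Complex.mul_im]
      linear_combination r ^ 2 / 2 * hVB
  have v1 := congrArg Complex.re hb
  have v2 := congrArg Complex.im hb
  simp only [Complex.mul_re, Complex.mul_im] at v1 v2
  constructor
  · ext i
    fin_cases i
    · simp [spinTangent]; linarith
    · simp [spinTangent]; linarith
    · simp [spinTangent]; linarith
  · ext i
    fin_cases i
    · simp [spinNormal]; linarith
    · simp [spinNormal]; linarith
    · simp [spinNormal]; linarith

/-! ### Smooth square roots and the lift away from one tangent direction -/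

theorem contDiff_complex_mk {G : Type*} [NormedAddCommGroup G] [NormedSpace ℝ G] {f g : G → ℝ}
    (hf : ContDiff ℝ ∞ f) (hg : ContDiff ℝ ∞ g) :
    ContDiff ℝ ∞ (fun t => (⟨f t, g t⟩ : ℂ)) := by
  have h : ContDiff ℝ ∞ (fun t => (f t : ℂ) + (g t : ℂ) * Complex.I) :=
    (Complex.ofRealCLM.contDiff.comp hf).add ((Complex.ofRealCLM.contDiff.comp hg).mul
      contDiff_const)
  convert h using 2 with t
  exact Complex.mk_eq_add_mul_I _ _

theorem contDiff_primitive {f : ℝ → ℂ} (hf : ContDiff ℝ ∞ f) :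
    ContDiff ℝ ∞ (fun t => ∫ s in (0 : ℝ)..t, f s) := by
  have hd : ∀ t, HasDerivAt (fun t => ∫ s in (0 : ℝ)..t, f s) (f t) t := fun t =>
    intervalIntegral.integral_hasDerivAt_right (hf.continuous.intervalIntegrable _ _)
      (hf.continuous.stronglyMeasurableAtFilter _ _) hf.continuous.continuousAt
  rw [contDiff_infty_iff_deriv]
  refine ⟨fun t => (hd t).differentiableAt, ?_⟩
  rwa [show deriv (fun t => ∫ s in (0 : ℝ)..t, f s) = f from funext fun t => (hd t).deriv]

/-- A nonvanishing smooth function of period `2` has a smooth square root, which is periodic up to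
a sign. -/
theorem exists_smooth_sqrt {f : ℝ → ℂ} (hf : ContDiff ℝ ∞ f) (h0 : ∀ t, f t ≠ 0)
    (hp : Function.Periodic f 2) :
    ∃ (a : ℝ → ℂ) (σ : ℝ), ContDiff ℝ ∞ a ∧ (∀ t, a t * a t = f t) ∧ (σ = 1 ∨ σ = -1) ∧
      ∀ t, a (t + 2) = σ * a t := by
  have hf' : ContDiff ℝ ∞ (deriv f) := (contDiff_infty_iff_deriv.1 hf).2
  obtain ⟨g, hg⟩ : ∃ g : ℝ → ℂ, g = fun t => deriv f t * (f t)⁻¹ := ⟨_, rfl⟩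
  have hgs : ContDiff ℝ ∞ g := hg ▸ hf'.mul (hf.inv h0)
  have hgp : Function.Periodic g 2 := by
    intro t
    have h1 : deriv f (t + 2) = deriv f t := by
      rw [← deriv_comp_add_const]
      congr 1
      exact funext hp
    simp only [hg, h1, hp t]
  -- `Φ` integrates the logarithmic derivative `f'/f`, so `f = f 0 · exp Φ` and the root is `z · exp
  -- (Φ/2)` with `z² = f 0`. Periodicity of `f` gives `exp (Φ 2) = 1`, so the multiplier `exp (Φ 2 /
  -- 2)` is a sign.
  obtain ⟨Φ, hΦ⟩ : ∃ Φ : ℝ → ℂ, Φ = fun t => ∫ s in (0 : ℝ)..t, g s := ⟨_, rfl⟩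
  have hΦs : ContDiff ℝ ∞ Φ := hΦ ▸ contDiff_primitive hgs
  have hΦd : ∀ t, HasDerivAt Φ (g t) t := fun t => hΦ ▸
    intervalIntegral.integral_hasDerivAt_right (hgs.continuous.intervalIntegrable _ _)
      (hgs.continuous.stronglyMeasurableAtFilter _ _) hgs.continuous.continuousAt
  have hΦ0 : Φ 0 = 0 := by simp [hΦ]
  have hΦ2 : ∀ t, Φ (t + 2) = Φ t + Φ 2 := by
    intro t
    simp only [hΦ]
    have h1 := hgp.intervalIntegral_add_eq t 0
    rw [zero_add] at h1
    rw [← h1, intervalIntegral.integral_add_adjacent_intervals] <;>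
      exact hgs.continuous.intervalIntegrable _ _
  have hexp : ∀ t, f t = f 0 * Complex.exp (Φ t) := by
    have hd : ∀ t, HasDerivAt (fun t => f t * Complex.exp (-Φ t)) 0 t := by
      intro t
      have h1 := ((hf.differentiable (by simp) t).hasDerivAt).mul (hΦd t).neg.cexp
      refine h1.congr_deriv ?_
      have := h0 t
      simp only [hg]
      field_simp
      simp
    intro t
    have hc := is_const_of_deriv_eq_zero (fun t => (hd t).differentiableAt)
      (fun t => (hd t).deriv) t 0
    simp only [hΦ0, neg_zero, Complex.exp_zero, mul_one] at hc
    rw [← hc, mul_assoc, ← Complex.exp_add]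
    simp
  obtain ⟨z, hz⟩ := IsAlgClosed.exists_pow_nat_eq (f 0) (n := 2) two_pos
  have hσ : Complex.exp (Φ 2 / 2) = 1 ∨ Complex.exp (Φ 2 / 2) = -1 := by
    rw [← mul_self_eq_one_iff, ← Complex.exp_add, add_halves]
    have h1 := hexp 2
    have h2 := hp 0
    rw [zero_add] at h2
    rw [h2] at h1
    exact mul_left_cancel₀ (h0 0) (by rw [← h1, mul_one])
  have ha : ContDiff ℝ ∞ fun t => z * Complex.exp (Φ t / 2) :=
    contDiff_const.mul (hΦs.div_const 2).cexp
  have haa : ∀ t, z * Complex.exp (Φ t / 2) * (z * Complex.exp (Φ t / 2)) = f t := by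
    intro t
    have h1 : Complex.exp (Φ t / 2) * Complex.exp (Φ t / 2) = Complex.exp (Φ t) := by
      rw [← Complex.exp_add, add_halves]
    rw [hexp t, ← hz, ← h1]
    ring
  have hap : ∀ t, z * Complex.exp (Φ (t + 2) / 2)
      = Complex.exp (Φ 2 / 2) * (z * Complex.exp (Φ t / 2)) := by
    intro t
    rw [hΦ2, add_div, Complex.exp_add]
    ring
  rcases hσ with h | h
  · exact ⟨_, 1, ha, haa, Or.inl rfl, fun t => by rw [hap, h]; simp⟩
  · exact ⟨_, -1, ha, haa, Or.inr rfl, fun t => by rw [hap, h]; simp⟩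

/-- The pair of functions `a, b` is multiplied by `σ` along one period. -/
structure IsQuasiPeriodic (σ : ℝ) (a b : ℝ → ℂ) : Prop where
  sign : σ = 1 ∨ σ = -1
  fst : ∀ t, a (t + 2) = σ * a t
  snd : ∀ t, b (t + 2) = σ * b t

/-- The frame prescribes `a²` and `ab`, here `f` and `w`. Since `|a²| = (r/2)(1 + T 0)`, avoiding `T
0 = -1` keeps `f` nonzero; then `a` is a smooth root of `f` and `b = w/a` inherits the multiplier of
`a`. -/
theorem FramedLoop.exists_isSpinor_of_ne {ℓ : ℝ} (x : FramedLoop ℓ)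
    (h : ∀ t, unitTangent x.curve t 0 ≠ -1) :
    ∃ (a b : ℝ → ℂ) (σ : ℝ), IsSpinor x a b ∧ IsQuasiPeriodic σ a b := by
  have hT := contDiff_euclidean.1 x.smooth_unitTangent
  have hV := contDiff_euclidean.1 x.smooth_frame
  have hB := contDiff_euclidean.1 x.smooth_binormal
  have hr := x.smooth_speed
  obtain ⟨f, hf⟩ : ∃ f : ℝ → ℂ, f = fun t =>
      ⟨‖deriv x.curve t‖ / 2 * (x.frame t 1 + x.binormal t 2),
        ‖deriv x.curve t‖ / 2 * (x.binormal t 1 - x.frame t 2)⟩ := ⟨_, rfl⟩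
  obtain ⟨w, hw⟩ : ∃ w : ℝ → ℂ, w = fun t => ⟨-(‖deriv x.curve t‖ / 2 * x.frame t 0),
        -(‖deriv x.curve t‖ / 2 * x.binormal t 0)⟩ := ⟨_, rfl⟩
  have hfs : ContDiff ℝ ∞ f := hf ▸ contDiff_complex_mk
    ((hr.div_const 2).mul ((hV 1).add (hB 2))) ((hr.div_const 2).mul ((hB 1).sub (hV 2)))
  have hws : ContDiff ℝ ∞ w := hw ▸ contDiff_complex_mk
    ((hr.div_const 2).mul (hV 0)).neg ((hr.div_const 2).mul (hB 0)).neg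
  have hf0 : ∀ t, f t ≠ 0 := by
    intro t h0
    have h1 := congrArg Complex.re h0
    have h2 := congrArg Complex.im h0
    have hr2 : ‖deriv x.curve t‖ / 2 ≠ 0 := by
      have := x.speed_pos t
      positivity
    simp only [hf, Complex.zero_re, Complex.zero_im, mul_eq_zero, hr2, false_or] at h1 h2
    have hc := cross_frame_binormal (x.frame_inner_self t) (x.unitTangent_inner_frame t)
    have t0 := congrArg (fun v : E3 => v 0) hc
    simp only [cross_apply_zero (x.frame t)] at t0
    have hTT := x.unitTangent_inner_self t
    have q := frame_completeness hTT (x.frame_inner_self t) (x.unitTangent_inner_frame t)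
    have q11 := q 1 1
    have q22 := q 2 2
    change x.frame t 1 * x.binormal t 2 - x.frame t 2 * x.binormal t 1 = _ at t0
    change _ + _ + x.binormal t 1 * x.binormal t 1 = _ at q11
    change _ + _ + x.binormal t 2 * x.binormal t 2 = _ at q22
    simp only [if_true] at q11 q22
    rw [inner_eq_sum] at hTT
    have h3 : (1 + unitTangent x.curve t 0) ^ 2 = 0 := by
      have e : (x.frame t 1 + x.binormal t 2) ^ 2 + (x.binormal t 1 - x.frame t 2) ^ 2 = 0 := by
        rw [h1, h2]; ring
      linear_combination e - (q11 + q22 - hTT + 2 * t0)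
    exact h t (by linarith [pow_eq_zero_iff two_ne_zero |>.1 h3])
  have hfp : Function.Periodic f 2 := by
    intro t
    simp only [hf, x.periodic_deriv t, x.periodic_frame t, x.periodic_binormal t]
  have hwp : Function.Periodic w 2 := by
    intro t
    simp only [hw, x.periodic_deriv t, x.periodic_frame t, x.periodic_binormal t]
  obtain ⟨a, σ, ha, haf, hσ, hap⟩ := exists_smooth_sqrt hfs hf0 hfp
  have ha0 : ∀ t, a t ≠ 0 := fun t h => hf0 t (by rw [← haf, h, mul_zero])
  have hab : ∀ t, a t * (w t * (a t)⁻¹) = w t := fun t => by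
    have := ha0 t
    field_simp
  have key := fun t => spin_eq_of_mul_eq (x.speed_pos t) (x.unitTangent_inner_self t)
    (x.frame_inner_self t) (x.unitTangent_inner_frame t) (h t) (by rw [haf t, hf]; rfl)
    ((hab t).trans (by rw [hw]; rfl))
  have ht : ∀ t, deriv x.curve t = spinTangent (a t) (w t * (a t)⁻¹) := fun t => by
    rw [(key t).1, ← x.deriv_curve_eq]
  refine ⟨a, fun t => w t * (a t)⁻¹, σ, ⟨ha, hws.mul (ha.inv ha0), ht, fun t => ?_⟩,
    ⟨hσ, hap, fun t => ?_⟩⟩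
  · rw [← norm_spinTangent, ← ht, (key t).2]
  · simp only [hwp t, hap]
    rcases hσ with rfl | rfl <;> simp [mul_comm]

/-! ### Rotating a missed tangent direction into standard position -/

/-- The image of a framed loop under a rotation. -/
def FramedLoop.rotate {ℓ : ℝ} (x : FramedLoop ℓ) (R : E3 ≃ₗᵢ[ℝ] E3) : FramedLoop ℓ where
  curve t := R (x.curve t)
  frame t := R (x.frame t)
  smooth_curve := (R.toContinuousLinearEquiv : E3 →L[ℝ] E3).contDiff.comp x.smooth_curve
  smooth_frame := (R.toContinuousLinearEquiv : E3 →L[ℝ] E3).contDiff.comp x.smooth_frame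
  periodic_curve t := congrArg R (x.periodic_curve t)
  periodic_frame t := congrArg R (x.periodic_frame t)
  immersed t := by
    rw [deriv_map', ← norm_ne_zero_iff, R.norm_map]
    exact (x.speed_pos t).ne'
  unit_frame t := by rw [R.norm_map, x.unit_frame]
  normal_frame t := by rw [deriv_map', R.inner_map_map, x.normal_frame]
  length_eq := by
    refine Eq.trans ?_ x.length_eq
    simp only [length, deriv_map', R.norm_map]

theorem FramedLoop.congruent_rotate {ℓ : ℝ} (x : FramedLoop ℓ) {R : E3 ≃ₗᵢ[ℝ] E3}
    (hR : LinearMap.det (R.toLinearEquiv : E3 →ₗ[ℝ] E3) = 1) : Congruent x (x.rotate R) :=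
  ⟨R, 0, 0, hR, fun t => by simp [rotate], fun t => by simp [rotate, twistFrame]⟩

theorem det_reflection_span_singleton {u : E3} (hu : u ≠ 0) :
    LinearMap.det ((ℝ ∙ u).reflection.toLinearEquiv : E3 →ₗ[ℝ] E3) = 1 := by
  have h := (ℝ ∙ u).det_reflection
  have h2 := Submodule.finrank_add_finrank_orthogonal (ℝ ∙ u)
  rw [finrank_span_singleton hu] at h2
  have h3 : Module.finrank ℝ E3 = 3 := by simp
  rw [show Module.finrank ℝ ↥(ℝ ∙ u)ᗮ = 2 by omega] at h
  simpa using h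

/-- The half turn about the line through `u + v` exchanges the unit vectors `u` and `v`, and in
dimension three it has determinant `(-1)² = 1`. -/
theorem exists_rotation_map_eq {u v : E3} (hu : ‖u‖ = 1) (hv : ‖v‖ = 1) (huv : u + v ≠ 0) :
    ∃ R : E3 ≃ₗᵢ[ℝ] E3, LinearMap.det (R.toLinearEquiv : E3 →ₗ[ℝ] E3) = 1 ∧ R u = v := by
  refine ⟨(ℝ ∙ (u + v)).reflection, det_reflection_span_singleton huv, ?_⟩
  · rw [Submodule.reflection_singleton_apply]
    have h1 : ‖u + v‖ ^ 2 = 2 * ⟪u + v, u⟫_ℝ := by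
      rw [← real_inner_self_eq_norm_sq, real_inner_add_add_self, inner_add_left,
        real_inner_self_eq_norm_sq, real_inner_self_eq_norm_sq, hu, hv, real_inner_comm]
      ring
    have h2 : ⟪u + v, u⟫_ℝ ≠ 0 := by
      intro h
      rw [h, mul_zero, sq_eq_zero_iff, norm_eq_zero] at h1
      exact huv h1
    have h3 : ⟪u + v, u⟫_ℝ / ‖u + v‖ ^ 2 = 1 / 2 := by
      rw [h1]
      field_simp
    simp only [RCLike.ofReal_real_eq_id, id_eq]
    rw [h3]
    module

/-- The cone over the tangent curve is a `C¹` image of `ℝ²` in `ℝ³`, so its complement is dense and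
meets the half-space `w 0 > 0`. Positivity of `u 0` keeps `u` away from `-(1, 0, 0)`, so that a half
turn can carry it to `(1, 0, 0)`. -/
theorem exists_avoiding_direction {ℓ : ℝ} (x : FramedLoop ℓ) :
    ∃ u : E3, ‖u‖ = 1 ∧ 0 < u 0 ∧ ∀ t, unitTangent x.curve t ≠ -u := by
  have hs : ContDiff ℝ 1 (fun p : ℝ × ℝ => p.1 • unitTangent x.curve p.2) :=
    contDiff_fst.smul ((x.smooth_unitTangent.of_le (by exact_mod_cast le_top)).comp contDiff_snd)
  have hd := hs.dense_compl_range_of_finrank_lt_finrank (by simp)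
  have ho : IsOpen {w : E3 | 0 < w 0} :=
    isOpen_lt continuous_const (by fun_prop)
  obtain ⟨w, hw0, hw⟩ := hd.inter_open_nonempty _ ho ⟨!₂[1, 0, 0], by simp⟩
  have hwn : 0 < ‖w‖ := by
    rw [norm_pos_iff]
    rintro rfl
    simp at hw0
  refine ⟨‖w‖⁻¹ • w, ?_, ?_, fun t ht => hw ⟨(-‖w‖, t), ?_⟩⟩
  · rw [norm_smul, norm_inv, norm_norm, inv_mul_cancel₀ hwn.ne']
  · have : 0 < w 0 := hw0
    simp only [PiLp.smul_apply, smul_eq_mul]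
    positivity
  · simp only [ht]
    rw [neg_smul, smul_neg, neg_neg, smul_inv_smul₀ hwn.ne']

theorem FramedLoop.exists_congruent_isSpinor {ℓ : ℝ} (x : FramedLoop ℓ) :
    ∃ (y : FramedLoop ℓ) (a b : ℝ → ℂ) (σ : ℝ),
      Congruent x y ∧ IsSpinor y a b ∧ IsQuasiPeriodic σ a b := by
  obtain ⟨u, hu, hu0, hux⟩ := exists_avoiding_direction x
  obtain ⟨v, hv⟩ : ∃ v : E3, v = !₂[1, 0, 0] := ⟨_, rfl⟩
  have hv0 : v 0 = 1 := by simp [hv]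
  have hv1 : ‖v‖ = 1 := by rw [hv, norm_vec3]; simp
  obtain ⟨R, hR, hRu⟩ := exists_rotation_map_eq hu hv1 (fun h => by
    have := congrArg (fun w : E3 => w 0) h
    simp [hv0] at this
    linarith)
  obtain ⟨a, b, σ, h1, h2⟩ := (x.rotate R).exists_isSpinor_of_ne (fun t ht => by
    have hn := (x.rotate R).unitTangent_inner_self t
    have hrot : unitTangent (x.rotate R).curve t = R (unitTangent x.curve t) := by
      have := unitTangent_map R x.curve 0 t
      simp only [add_zero] at this
      exact this
    have h3 : unitTangent (x.rotate R).curve t = -v := by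
      rw [inner_eq_sum, ht] at hn
      have e1 : unitTangent (x.rotate R).curve t 1 = 0 := by nlinarith
      have e2 : unitTangent (x.rotate R).curve t 2 = 0 := by nlinarith
      ext i
      fin_cases i
      · simp [ht, hv0]
      · simp [e1, hv]
      · simp [e2, hv]
    rw [hrot, ← hRu, ← map_neg] at h3
    exact hux t (R.injective h3))
  exact ⟨_, a, b, σ, x.congruent_rotate hR, h1, h2⟩

/-! ### Smooth families of framed loops from spinor fields -/

/-- Induction on the order of differentiability, with the target space quantified inside because
differentiation under the integral replaces `F` by linear maps into `F`. -/
theorem contDiff_integral_parameter (n : ℕ) : ∀ {F : Type} [NormedAddCommGroup F]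
    [NormedSpace ℝ F] [CompleteSpace F] {H : (ℝ × ℝ) × ℝ → F}, ContDiff ℝ ∞ H →
    ContDiff ℝ n (fun p => ∫ u in (0 : ℝ)..1, H (p, u)) := by
  induction n with
  | zero =>
    intro F _ _ _ H hH
    have hc := hH.continuous
    exact contDiff_zero.2 (intervalIntegral.continuous_parametric_intervalIntegral_of_continuous'
      (f := fun p u => H (p, u)) (by fun_prop) 0 1)
  | succ n ih =>
    intro F _ _ _ H hH
    obtain ⟨H', hH'⟩ : ∃ H' : (ℝ × ℝ) × ℝ → (ℝ × ℝ) →L[ℝ] F,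
        H' = fun q => (fderiv ℝ H q).comp (ContinuousLinearMap.inl ℝ (ℝ × ℝ) ℝ) := ⟨_, rfl⟩
    have hs : ContDiff ℝ ∞ H' :=
      hH' ▸ (hH.fderiv_right (m := ∞) (by simp)).clm_comp contDiff_const
    have hc := hH.continuous
    have hc' := hs.continuous
    have hd : ∀ p u, HasFDerivAt (fun p => H (p, u)) (H' (p, u)) p := by
      intro p u
      have h1 : HasFDerivAt H (fderiv ℝ H (p, u)) (p, u) :=
        (hH.differentiable (by simp) _).hasFDerivAt
      rw [hH']
      exact h1.comp p (hasFDerivAt_prodMk_left p u)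
    have key : ∀ p, HasFDerivAt (fun p => ∫ u in (0 : ℝ)..1, H (p, u))
        (∫ u in (0 : ℝ)..1, H' (p, u)) p := by
      intro p
      obtain ⟨C, hC⟩ := ((isCompact_closedBall p 1).prod (isCompact_uIcc (a := 0) (b := 1)))
        |>.exists_bound_of_continuousOn hc'.continuousOn
      refine intervalIntegral.hasFDerivAt_integral_of_dominated_of_fderiv_le
        (F := fun p u => H (p, u)) (F' := fun p u => H' (p, u)) (bound := fun _ => C)
        (Metric.ball_mem_nhds p one_pos) ?_ ?_ ?_ ?_ ?_ ?_
      · exact Filter.Eventually.of_forall fun x =>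
          (by fun_prop : Continuous fun t => H (x, t)).aestronglyMeasurable
      · exact (by fun_prop : Continuous fun t => H (p, t)).intervalIntegrable _ _
      · exact (by fun_prop : Continuous fun t => H' (p, t)).aestronglyMeasurable
      · exact Filter.Eventually.of_forall fun t ht x hx =>
          hC (x, t) ⟨Metric.ball_subset_closedBall hx, Set.uIoc_subset_uIcc ht⟩
      · exact intervalIntegrable_const
      · exact Filter.Eventually.of_forall fun t _ x _ => hd x t
    push_cast
    rw [contDiff_succ_iff_fderiv]
    refine ⟨fun p => (key p).differentiableAt, by simp, ?_⟩
    rw [show fderiv ℝ (fun p => ∫ u in (0 : ℝ)..1, H (p, u))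
      = fun p => ∫ u in (0 : ℝ)..1, H' (p, u) from funext fun p => (key p).fderiv]
    exact ih hs

/-- The substitution `s = p.2 * u` moves the variable endpoint into the integrand. -/
theorem contDiff_parametric_primitive {X : ℝ × ℝ → E3} (hX : ContDiff ℝ ∞ X) :
    ContDiff ℝ ∞ (fun p : ℝ × ℝ => ∫ s in (0 : ℝ)..p.2, X (p.1, s)) := by
  have h : ∀ p : ℝ × ℝ, ∫ s in (0 : ℝ)..p.2, X (p.1, s)
      = p.2 • ∫ u in (0 : ℝ)..1, X (p.1, p.2 * u) := by
    intro p
    rw [intervalIntegral.smul_integral_comp_mul_left (fun s => X (p.1, s))]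
    simp
  rw [funext h]
  refine contDiff_snd.smul (contDiff_infty.2 fun n => ?_)
  exact contDiff_integral_parameter n (H := fun q : (ℝ × ℝ) × ℝ => X (q.1.1, q.1.2 * q.2))
    (hX.comp (contDiff_fst.fst.prodMk (contDiff_fst.snd.mul contDiff_snd)))

/-- All these expressions are quadratic, so spinors that are periodic only up to sign still induce
periodic frames. -/
theorem spinTangent_mul_of_sign {σ : ℝ} (hσ : σ = 1 ∨ σ = -1) (a b : ℂ) :
    spinTangent (σ * a) (σ * b) = spinTangent a b ∧ spinNormal (σ * a) (σ * b) = spinNormal a b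
      ∧ spinSpeed (σ * a) (σ * b) = spinSpeed a b := by
  rcases hσ with rfl | rfl <;> simp [spinTangent, spinNormal, spinSpeed]

theorem integral_eq_zero_of_periodic_primitive (y : ℝ → E3) (hy : ContDiff ℝ ∞ y)
    (hp : Function.Periodic y 2) : ∫ t in (0 : ℝ)..2, deriv y t = 0 := by
  rw [intervalIntegral.integral_deriv_eq_sub (fun t _ => hy.differentiable (by simp) t)
    ((contDiff_infty_iff_deriv.1 hy).2.continuous.intervalIntegrable _ _)]
  have := hp 0
  rw [zero_add] at this
  rw [this, sub_self]

/-- A smooth family of spinor fields satisfying the closing and the length conditions induces a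
smooth family of framed loops. -/
theorem exists_family {ℓ σ : ℝ} {y : FramedLoop ℓ} {A B : ℝ → ℝ → ℂ}
    (hA : ContDiff ℝ ∞ fun p : ℝ × ℝ => A p.1 p.2) (hB : ContDiff ℝ ∞ fun p : ℝ × ℝ => B p.1 p.2)
    (hq : ∀ ε, IsQuasiPeriodic σ (A ε) (B ε)) (h0 : ∀ ε t, 0 < spinSpeed (A ε t) (B ε t))
    (hc : ∀ ε, ∫ t in (0 : ℝ)..2, spinTangent (A ε t) (B ε t) = 0)
    (hl : ∀ ε, ∫ t in (0 : ℝ)..2, spinSpeed (A ε t) (B ε t) = ℓ)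
    (hy : IsSpinor y (A 0) (B 0)) :
    ∃ F : ℝ → FramedLoop ℓ, IsSmoothFamily F ∧ (∀ ε, IsSpinor (F ε) (A ε) (B ε)) ∧
      Congruent y (F 0) := by
  have hX : ContDiff ℝ ∞ fun p : ℝ × ℝ => spinTangent (A p.1 p.2) (B p.1 p.2) :=
    contDiff_spinTangent hA hB
  have hN : ContDiff ℝ ∞ fun p : ℝ × ℝ =>
      (spinSpeed (A p.1 p.2) (B p.1 p.2))⁻¹ • spinNormal (A p.1 p.2) (B p.1 p.2) :=
    ((contDiff_spinSpeed hA hB).inv fun p => (h0 p.1 p.2).ne').smul (contDiff_spinNormal hA hB)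
  have hXε := contDiff_slice hX
  have hNε := contDiff_slice hN
  simp only at hXε hNε
  have hG := contDiff_parametric_primitive hX
  simp only at hG
  have hsgn := fun ε t => spinTangent_mul_of_sign (hq 0).sign (A ε t) (B ε t)
  have hXp : ∀ ε, Function.Periodic (fun t => spinTangent (A ε t) (B ε t)) 2 := by
    intro ε t
    simp only [(hq ε).fst, (hq ε).snd, (hsgn ε t).1]
  have hd : ∀ ε t, HasDerivAt (fun t => ∫ s in (0 : ℝ)..t, spinTangent (A ε s) (B ε s))
      (spinTangent (A ε t) (B ε t)) t := fun ε t =>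
    intervalIntegral.integral_hasDerivAt_right ((hXε ε).continuous.intervalIntegrable _ _)
      ((hXε ε).continuous.stronglyMeasurableAtFilter _ _) (hXε ε).continuous.continuousAt
  have hdd := fun ε t => (hd ε t).deriv
  refine ⟨fun ε => ⟨fun t => ∫ s in (0 : ℝ)..t, spinTangent (A ε s) (B ε s),
    fun t => (spinSpeed (A ε t) (B ε t))⁻¹ • spinNormal (A ε t) (B ε t),
    contDiff_slice hG ε, hNε ε, ?_, ?_, ?_, ?_, ?_, ?_⟩, ⟨hG, hN⟩, ?_, ?_⟩
  · intro t
    simp only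
    have h1 := (hXp ε).intervalIntegral_add_eq t 0
    rw [zero_add, hc] at h1
    rw [← intervalIntegral.integral_add_adjacent_intervals (b := t), h1, add_zero] <;>
      exact (hXε ε).continuous.intervalIntegrable _ _
  · intro t
    simp only [(hq ε).fst, (hq ε).snd, (hsgn ε t).2.1, (hsgn ε t).2.2]
  · intro t
    rw [hdd, ← norm_ne_zero_iff, norm_spinTangent]
    exact (h0 ε t).ne'
  · intro t
    rw [norm_smul, norm_inv, norm_spinNormal, Real.norm_of_nonneg (h0 ε t).le,
      inv_mul_cancel₀ (h0 ε t).ne']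
  · intro t
    rw [hdd, real_inner_smul_right, inner_spinTangent_spinNormal, mul_zero]
  · simp only [length, hdd, norm_spinTangent, hl]
  · intro ε
    exact ⟨contDiff_slice hA ε, contDiff_slice hB ε, hdd ε,
      fun t => smul_inv_smul₀ (h0 ε t).ne' _⟩
  -- The spinor determines the curve only up to translation, and the primitive starts at the origin.
  · refine ⟨LinearIsometryEquiv.refl ℝ E3, -y.curve 0, 0, LinearMap.det_id, fun t => ?_,
      fun t => ?_⟩
    · simp only [LinearIsometryEquiv.coe_refl, id_eq]
      have h1 := intervalIntegral.integral_eq_sub_of_hasDerivAt (a := 0) (b := t)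
        (fun s _ => (y.smooth_curve.differentiable (by simp) s).hasDerivAt)
        (y.smooth_deriv.continuous.intervalIntegrable _ _)
      simp only [hy.tangent] at h1
      rw [h1, sub_eq_add_neg]
    · simp [twistFrame, hy.frame_eq]

/-! ### The Hermitian product of complex functions -/

open ComplexConjugate in
/-- The Hermitian product of two complex functions over one period. -/
def herm (f g : ℝ → ℂ) : ℂ := ∫ t in (0 : ℝ)..2, conj (f t) * g t

section Herm

variable {f g k : ℝ → ℂ}

open ComplexConjugate

theorem herm_lin_right (hk : Continuous k) (hf : Continuous f) (hg : Continuous g) (c s : ℂ) :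
    herm k (fun t => c * f t + s * g t) = c * herm k f + s * herm k g := by
  simp only [herm]
  rw [← intervalIntegral.integral_const_mul, ← intervalIntegral.integral_const_mul,
    ← intervalIntegral.integral_add]
  · congr 1
    funext t
    ring
  · exact (by fun_prop : Continuous fun t => c * (conj (k t) * f t)).intervalIntegrable _ _
  · exact (by fun_prop : Continuous fun t => s * (conj (k t) * g t)).intervalIntegrable _ _

theorem herm_conj (f g : ℝ → ℂ) : conj (herm f g) = herm g f := by
  simp only [herm, intervalIntegral, map_sub]
  rw [← integral_conj, ← integral_conj]
  congr 2 <;>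
  · funext t
    simp [mul_comm]

theorem herm_lin_left (hk : Continuous k) (hf : Continuous f) (hg : Continuous g) (c s : ℂ) :
    herm (fun t => c * f t + s * g t) k = conj c * herm f k + conj s * herm g k := by
  rw [← herm_conj, herm_lin_right hk hf hg, map_add, map_mul, map_mul, herm_conj, herm_conj]

theorem herm_self (f : ℝ → ℂ) : herm f f = ((∫ t in (0 : ℝ)..2, Complex.normSq (f t) : ℝ) : ℂ) := by
  simp only [herm, ← Complex.normSq_eq_conj_mul_self]
  exact intervalIntegral.integral_ofReal

theorem herm_self_eq_re (f : ℝ → ℂ) : herm f f = ((herm f f).re : ℂ) := by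
  rw [herm_self, Complex.ofReal_re]

theorem continuous_normSq_comp (hf : Continuous f) : Continuous fun t => Complex.normSq (f t) :=
  Complex.continuous_normSq.comp hf

theorem herm_re (hf : Continuous f) (hg : Continuous g) :
    (herm f g).re = ∫ t in (0 : ℝ)..2, ((f t).re * (g t).re + (f t).im * (g t).im) := by
  have hc : Continuous fun t => conj (f t) * g t := by fun_prop
  have h := Complex.reCLM.intervalIntegral_comp_comm
    (hc.intervalIntegrable (μ := MeasureTheory.volume) 0 2)
  simp only [Complex.reCLM_apply] at h
  rw [herm, ← h]
  simp

theorem herm_im (hf : Continuous f) (hg : Continuous g) :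
    (herm f g).im = ∫ t in (0 : ℝ)..2, ((f t).re * (g t).im - (f t).im * (g t).re) := by
  have hc : Continuous fun t => conj (f t) * g t := by fun_prop
  have h := Complex.imCLM.intervalIntegral_comp_comm
    (hc.intervalIntegrable (μ := MeasureTheory.volume) 0 2)
  simp only [Complex.imCLM_apply] at h
  rw [herm, ← h]
  simp [sub_eq_add_neg]

/-- Integration by parts. -/
theorem herm_deriv_left {σ : ℝ} (hσ : σ = 1 ∨ σ = -1) (hf : ContDiff ℝ ∞ f)
    (hg : ContDiff ℝ ∞ g) (pf : ∀ t, f (t + 2) = σ * f t) (pg : ∀ t, g (t + 2) = σ * g t) :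
    herm (deriv f) g = -herm f (deriv g) := by
  have hf' := (contDiff_infty_iff_deriv.1 hf).2.continuous
  have hg' := (contDiff_infty_iff_deriv.1 hg).2.continuous
  have hfc := hf.continuous
  have hgc := hg.continuous
  have hd : ∀ t, HasDerivAt (fun t => conj (f t) * g t)
      (conj (deriv f t) * g t + conj (f t) * deriv g t) t := fun t =>
    ((hf.differentiable (by simp) t).hasDerivAt.star).mul
      (hg.differentiable (by simp) t).hasDerivAt
  have c1 : Continuous fun t => conj (deriv f t) * g t := by fun_prop
  have c2 : Continuous fun t => conj (f t) * deriv g t := by fun_prop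
  have h := intervalIntegral.integral_eq_sub_of_hasDerivAt (fun t _ => hd t)
    ((c1.add c2).intervalIntegrable 0 2)
  rw [intervalIntegral.integral_add (c1.intervalIntegrable _ _) (c2.intervalIntegrable _ _)] at h
  have h1 := pf 0
  have h2 := pg 0
  rw [zero_add] at h1 h2
  rw [h1, h2] at h
  -- The boundary terms cancel because `σ² = 1`.
  have h3 : conj ((σ : ℂ) * f 0) * (σ * g 0) - conj (f 0) * g 0 = 0 := by
    rcases hσ with rfl | rfl <;> simp
  rw [h3] at h
  exact eq_neg_of_add_eq_zero_left h

theorem deriv_quasiPeriodic {σ : ℝ} (pf : ∀ t, f (t + 2) = σ * f t) (t : ℝ) :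
    deriv f (t + 2) = σ * deriv f t := by
  rw [← deriv_comp_add_const, funext pf, deriv_const_mul_field]

/-- Even if `f` is antiperiodic, `|f|²` has period `2`, so one period controls `f` everywhere. -/
theorem eq_zero_of_herm_self {σ : ℝ} (hf : Continuous f) (pf : ∀ t, f (t + 2) = σ * f t)
    (hσ : σ = 1 ∨ σ = -1) (h : herm f f = 0) (t : ℝ) : f t = 0 := by
  by_contra h0
  have hp : Function.Periodic (fun t => Complex.normSq (f t)) 2 := by
    intro t
    simp only [pf]
    rcases hσ with rfl | rfl <;> simp
  obtain ⟨s, hs, hst⟩ := hp.exists_mem_Ico₀ two_pos t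
  have h1 : 0 < ∫ t in (0 : ℝ)..2, Complex.normSq (f t) :=
    intervalIntegral.integral_pos two_pos (continuous_normSq_comp hf).continuousOn
      (fun x _ => Complex.normSq_nonneg _)
      ⟨s, Set.Ico_subset_Icc_self hs, by rw [← hst]; exact Complex.normSq_pos.2 h0⟩
  rw [herm_self, Complex.ofReal_eq_zero] at h
  exact h1.ne' h

theorem integral_spinSpeed (hf : Continuous f) (hg : Continuous g) :
    ∫ t in (0 : ℝ)..2, spinSpeed (f t) (g t) = (herm f f).re + (herm g g).re := by
  rw [herm_self, herm_self, Complex.ofReal_re, Complex.ofReal_re,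
    ← intervalIntegral.integral_add ((continuous_normSq_comp hf).intervalIntegrable _ _)
    ((continuous_normSq_comp hg).intervalIntegrable _ _)]
  simp only [spinSpeed_eq]

/-- This identifies closing of the curve with `L²`-orthogonality and equal norms of the two
components. -/
theorem integral_spinTangent (hf : Continuous f) (hg : Continuous g) :
    ∫ t in (0 : ℝ)..2, spinTangent (f t) (g t)
      = !₂[(herm f f).re - (herm g g).re, 2 * (herm f g).re, 2 * (herm f g).im] := by
  have hc : Continuous fun t => spinTangent (f t) (g t) := by
    have h1 : Continuous fun t => (f t).re := Complex.continuous_re.comp hf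
    have h2 : Continuous fun t => (f t).im := Complex.continuous_im.comp hf
    have h3 : Continuous fun t => (g t).re := Complex.continuous_re.comp hg
    have h4 : Continuous fun t => (g t).im := Complex.continuous_im.comp hg
    refine (PiLp.continuous_toLp 2 _).comp (continuous_pi fun i => ?_)
    fin_cases i
    · exact (((h1.pow 2).add (h2.pow 2)).sub (h3.pow 2)).sub (h4.pow 2)
    · exact continuous_const.mul ((h1.mul h3).add (h2.mul h4))
    · exact continuous_const.mul ((h1.mul h4).sub (h2.mul h3))
  ext i
  have h := (EuclideanSpace.proj (𝕜 := ℝ) i).intervalIntegral_comp_comm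
    (hc.intervalIntegrable (μ := MeasureTheory.volume) 0 2)
  simp only [PiLp.proj_apply] at h
  rw [← h]
  fin_cases i
  · simp only [spinTangent, herm_self, Complex.ofReal_re]
    rw [← intervalIntegral.integral_sub ((continuous_normSq_comp hf).intervalIntegrable _ _)
      ((continuous_normSq_comp hg).intervalIntegrable _ _)]
    congr 1
    funext t
    simp [Complex.normSq_apply]
    ring
  · simp [spinTangent, herm_re hf hg]
  · simp [spinTangent, herm_im hf hg]

end Herm

/-- The closing and length conditions for a spinor field. -/
structure IsClosedSpinor (ℓ : ℝ) (a b : ℝ → ℂ) : Prop where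
  fst : herm a a = (ℓ / 2 : ℝ)
  snd : herm b b = (ℓ / 2 : ℝ)
  orth : herm a b = 0

namespace IsSpinor

variable {ℓ : ℝ} {x : FramedLoop ℓ} {a b : ℝ → ℂ}

theorem isClosedSpinor (h : IsSpinor x a b) : IsClosedSpinor ℓ a b := by
  have ha := h.smooth_fst.continuous
  have hb := h.smooth_snd.continuous
  have h1 := integral_eq_zero_of_periodic_primitive _ x.smooth_curve x.periodic_curve
  simp only [h.tangent] at h1
  rw [integral_spinTangent ha hb] at h1
  have h2 : ∫ t in (0 : ℝ)..2, spinSpeed (a t) (b t) = ℓ := by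
    rw [← x.length_eq, length]
    simp only [h.speed]
  rw [integral_spinSpeed ha hb] at h2
  have e0 := congrArg (fun v : E3 => v 0) h1
  have e1 := congrArg (fun v : E3 => v 1) h1
  have e2 := congrArg (fun v : E3 => v 2) h1
  simp at e0 e1 e2
  refine ⟨?_, ?_, Complex.ext e1 e2⟩
  · rw [herm_self_eq_re]
    congr 1
    linarith
  · rw [herm_self_eq_re]
    congr 1
    linarith

theorem energy_eq_herm (h : IsSpinor x a b) :
    energy x.curve x.frame = 4 * ((herm (deriv a) (deriv a)).re + (herm (deriv b) (deriv b)).re) := by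
  have ha := (contDiff_infty_iff_deriv.1 h.smooth_fst).2.continuous
  have hb := (contDiff_infty_iff_deriv.1 h.smooth_snd).2.continuous
  rw [h.energy_eq, intervalIntegral.integral_const_mul, ← integral_spinSpeed ha hb]
  simp only [spinSpeed_eq]

end IsSpinor

/-! ### The Euler-Lagrange equation -/

open ComplexConjugate

theorem herm_neg_right (f g : ℝ → ℂ) : herm f (fun t => -g t) = -herm f g := by
  simp [herm]

theorem herm_neg_left (f g : ℝ → ℂ) : herm (fun t => -f t) g = -herm f g := by
  simp [herm]

theorem herm_rotate {f g : ℝ → ℂ} (hf : Continuous f) (hg : Continuous g) (c s : ℝ) :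
    (herm (fun t => c * f t + s * g t) (fun t => c * f t + s * g t)).re
      = c ^ 2 * (herm f f).re + 2 * (c * s) * (herm f g).re + s ^ 2 * (herm g g).re := by
  have hk : Continuous fun t => (c : ℂ) * f t + s * g t := by fun_prop
  have h := congrArg Complex.re (herm_conj f g)
  rw [Complex.conj_re] at h
  rw [herm_lin_left hk hf hg, herm_lin_right hf hf hg, herm_lin_right hg hf hg]
  simp only [Complex.conj_ofReal, Complex.add_re, Complex.re_ofReal_mul, ← h]
  ring

/-- Small rotations of the first component of a spinor field keep it nonzero. -/
theorem eventually_spinSpeed_pos {σ : ℝ} {a b α : ℝ → ℂ} (hσ : σ = 1 ∨ σ = -1)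
    (ha : Continuous a) (hb : Continuous b) (hα : Continuous α)
    (pa : ∀ t, a (t + 2) = σ * a t) (pb : ∀ t, b (t + 2) = σ * b t)
    (pα : ∀ t, α (t + 2) = σ * α t) (h0 : ∀ t, 0 < spinSpeed (a t) (b t)) :
    ∀ᶠ θ : ℝ in nhds 0, ∀ t,
      0 < spinSpeed ((Real.cos θ : ℂ) * a t + (Real.sin θ : ℂ) * α t) (b t) := by
  have hc : Continuous fun p : ℝ × ℝ =>
      spinSpeed ((Real.cos p.1 : ℂ) * a p.2 + (Real.sin p.1 : ℂ) * α p.2) (b p.2) := by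
    simp only [spinSpeed_eq]
    have h1 : Continuous fun p : ℝ × ℝ =>
        (Real.cos p.1 : ℂ) * a p.2 + (Real.sin p.1 : ℂ) * α p.2 := by fun_prop
    have h2 : Continuous fun p : ℝ × ℝ => b p.2 := by fun_prop
    exact (Complex.continuous_normSq.comp h1).add (Complex.continuous_normSq.comp h2)
  have h1 : ∀ᶠ θ : ℝ in nhds 0, ∀ t ∈ Set.Icc (0 : ℝ) 2,
      0 < spinSpeed ((Real.cos θ : ℂ) * a t + (Real.sin θ : ℂ) * α t) (b t) := by
    refine isCompact_Icc.eventually_forall_of_forall_eventually fun t _ => ?_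
    refine hc.continuousAt.eventually (lt_mem_nhds ?_)
    simpa using h0 t
  filter_upwards [h1] with θ hθ t
  have hp : Function.Periodic (fun t =>
      spinSpeed ((Real.cos θ : ℂ) * a t + (Real.sin θ : ℂ) * α t) (b t)) 2 := by
    intro t
    simp only [pa, pb, pα]
    rw [← (spinTangent_mul_of_sign hσ (_ + _) (b t)).2.2]
    congr 1
    ring
  obtain ⟨s, hs, hst⟩ := hp.exists_mem_Ico₀ two_pos t
  rw [hst]
  exact hθ s (Set.Ico_subset_Icc_self hs)

/-- Replacing `a` by `cos θ · a + sin θ · α` preserves orthogonality to `b` and the norm, hence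
closing and length. The `θ`-derivative of the energy at `0` is `8 Re⟨a', α'⟩`. -/
theorem herm_deriv_re_eq_zero_of_isCriticalPoint {ℓ σ : ℝ} {y : FramedLoop ℓ} {a b α : ℝ → ℂ}
    (hy : IsSpinor y a b) (hq : IsQuasiPeriodic σ a b) (hcrit : IsCriticalPoint y.toModuli)
    (hα : ContDiff ℝ ∞ α) (pα : ∀ t, α (t + 2) = σ * α t) (h1 : herm a α = 0)
    (h2 : herm b α = 0) (h3 : herm α α = (ℓ / 2 : ℝ)) :
    (herm (deriv a) (deriv α)).re = 0 := by
  have hcl := hy.isClosedSpinor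
  have ha := hy.smooth_fst
  have hb := hy.smooth_snd
  have hac := ha.continuous
  have hbc := hb.continuous
  have hαc := hα.continuous
  have ha' := (contDiff_infty_iff_deriv.1 ha).2.continuous
  have hα' := (contDiff_infty_iff_deriv.1 hα).2.continuous
  obtain ⟨δ, hδ, hpos⟩ := Metric.eventually_nhds_iff.1
    (eventually_spinSpeed_pos hq.sign hac hbc hαc hq.fst hq.snd pα hy.speed_pos)
  -- A family must be immersed for every real `ε`, while nonvanishing is known only for `|θ| < δ`.
  -- This angle stays in that range and has nonzero velocity at `0`.
  obtain ⟨θ, hθ⟩ : ∃ θ : ℝ → ℝ, θ = fun ε => δ / 2 * Real.sin ε := ⟨_, rfl⟩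
  have hθs : ContDiff ℝ ∞ θ := hθ ▸ contDiff_const.mul Real.contDiff_sin
  have hθ0 : θ 0 = 0 := by simp [hθ]
  have hθd : HasDerivAt θ (δ / 2) 0 := by
    rw [hθ]
    simpa using (Real.hasDerivAt_sin 0).const_mul (δ / 2)
  have hθb : ∀ ε, dist (θ ε) 0 < δ := by
    intro ε
    rw [Real.dist_eq, sub_zero, hθ, abs_mul, abs_of_pos (by positivity)]
    have := Real.abs_sin_le_one ε
    nlinarith
  have hcoef : ∀ {f : ℝ → ℝ}, ContDiff ℝ ∞ f → ContDiff ℝ ∞ fun p : ℝ × ℝ => (f (θ p.1) : ℂ) :=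
    fun hf => Complex.ofRealCLM.contDiff.comp (hf.comp (hθs.comp contDiff_fst))
  obtain ⟨F, hF, hFs, hF0⟩ := exists_family (σ := σ) (y := y)
    (A := fun ε t => (Real.cos (θ ε) : ℂ) * a t + (Real.sin (θ ε) : ℂ) * α t)
    (B := fun _ t => b t)
    (((hcoef Real.contDiff_cos).mul (ha.comp contDiff_snd)).add
      ((hcoef Real.contDiff_sin).mul (hα.comp contDiff_snd)))
    (hb.comp contDiff_snd)
    (fun ε => ⟨hq.sign, fun t => by rw [hq.fst, pα]; ring, hq.snd⟩)
    (fun ε t => hpos (hθb ε) t)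
    (fun ε => by
      have hk : Continuous fun t =>
        (Real.cos (θ ε) : ℂ) * a t + (Real.sin (θ ε) : ℂ) * α t := by fun_prop
      rw [integral_spinTangent hk hbc, herm_rotate hac hαc, herm_lin_left hbc hac hαc, hcl.orth,
        ← herm_conj b α, h1, h2, h3, hcl.fst, hcl.snd]
      ext i
      fin_cases i
      · simp
        linear_combination ℓ / 2 * Real.sin_sq_add_cos_sq (θ ε)
      · simp
      · simp)
    (fun ε => by
      have hk : Continuous fun t =>
        (Real.cos (θ ε) : ℂ) * a t + (Real.sin (θ ε) : ℂ) * α t := by fun_prop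
      rw [integral_spinSpeed hk hbc, herm_rotate hac hαc, h1, h3, hcl.fst, hcl.snd]
      simp
      linear_combination ℓ / 2 * Real.sin_sq_add_cos_sq (θ ε))
    (by simpa [hθ0] using hy)
  have hE : ∀ ε, moduliEnergy (F ε).toModuli = 4 * ((Real.cos (θ ε) ^ 2
      * (herm (deriv a) (deriv a)).re + 2 * (Real.cos (θ ε) * Real.sin (θ ε))
      * (herm (deriv a) (deriv α)).re + Real.sin (θ ε) ^ 2 * (herm (deriv α) (deriv α)).re)
      + (herm (deriv b) (deriv b)).re) := by
    intro ε
    have hd : deriv (fun t => (Real.cos (θ ε) : ℂ) * a t + (Real.sin (θ ε) : ℂ) * α t)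
        = fun t => (Real.cos (θ ε) : ℂ) * deriv a t + (Real.sin (θ ε) : ℂ) * deriv α t := by
      funext t
      exact (((ha.differentiable (by simp) t).hasDerivAt.const_mul _).add
        ((hα.differentiable (by simp) t).hasDerivAt.const_mul _)).deriv
    have h := (hFs ε).energy_eq_herm
    rw [hd, herm_rotate ha' hα'] at h
    exact h
  have hd := hcrit F hF (Quotient.sound (s := congruenceSetoid ℓ) hF0).symm
  rw [funext hE] at hd
  have hc := hθd.cos
  have hs := hθd.sin
  have hd2 := (((((hc.fun_pow 2).mul_const (herm (deriv a) (deriv a)).re).fun_add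
    (((hc.fun_mul hs).const_mul 2).mul_const (herm (deriv a) (deriv α)).re)).fun_add
    ((hs.fun_pow 2).mul_const (herm (deriv α) (deriv α)).re)).add_const
    (herm (deriv b) (deriv b)).re).const_mul 4
  have h := hd2.unique hd
  simp [hθ0] at h
  rcases h with h | h
  · exact absurd h hδ.ne'
  · exact h

/-- The Euler-Lagrange equation for the first component of a critical spinor field. -/
theorem deriv_deriv_fst_of_isCriticalPoint {ℓ σ : ℝ} (hℓ : 0 < ℓ) {y : FramedLoop ℓ}
    {a b : ℝ → ℂ} (hy : IsSpinor y a b) (hq : IsQuasiPeriodic σ a b)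
    (hcrit : IsCriticalPoint y.toModuli) (t : ℝ) :
    -deriv (deriv a) t = (2 / ℓ : ℝ) * herm (deriv a) (deriv a) * a t
      + (2 / ℓ : ℝ) * herm (deriv b) (deriv a) * b t := by
  have hcl := hy.isClosedSpinor
  have ha := hy.smooth_fst
  have hb := hy.smooth_snd
  have ha' := (contDiff_infty_iff_deriv.1 ha).2
  have ha'' := (contDiff_infty_iff_deriv.1 ha').2
  have hac := ha.continuous
  have hbc := hb.continuous
  have pa' := deriv_quasiPeriodic hq.fst
  have pa'' := deriv_quasiPeriodic pa'
  obtain ⟨h, hh⟩ : ∃ h : ℝ → ℂ, h = fun t => -deriv (deriv a) t := ⟨_, rfl⟩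
  have hs : ContDiff ℝ ∞ h := hh ▸ ha''.neg
  have hhc := hs.continuous
  have e1 : herm a h = herm (deriv a) (deriv a) := by
    rw [hh, herm_neg_right, herm_deriv_left hq.sign ha ha' hq.fst pa']
  have e2 : herm b h = herm (deriv b) (deriv a) := by
    rw [hh, herm_neg_right, herm_deriv_left hq.sign hb ha' hq.snd pa']
  obtain ⟨p, hp⟩ : ∃ p : ℂ, p = (2 / ℓ : ℝ) * herm (deriv a) (deriv a) := ⟨_, rfl⟩
  obtain ⟨q, hqe⟩ : ∃ q : ℂ, q = (2 / ℓ : ℝ) * herm (deriv b) (deriv a) := ⟨_, rfl⟩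
  obtain ⟨g, hg⟩ : ∃ g : ℝ → ℂ, g = fun t => p * a t + q * b t := ⟨_, rfl⟩
  have hgc : Continuous g := by rw [hg]; fun_prop
  -- `g` is the `L²`-projection of `h = -a''` onto the span of `a` and `b`. The remainder `r` is an
  -- admissible direction up to scaling, and `⟨r, r⟩ = ⟨h, r⟩ = ⟨a', r'⟩`, which criticality forces
  -- to vanish.
  obtain ⟨r, hr⟩ : ∃ r : ℝ → ℂ, r = fun t => 1 * h t + (-1) * g t := ⟨_, rfl⟩
  have hrs : ContDiff ℝ ∞ r := by
    rw [hr, hg]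
    exact (contDiff_const.mul hs).add (contDiff_const.mul
      ((contDiff_const.mul ha).add (contDiff_const.mul hb)))
  have hrc := hrs.continuous
  have pr : ∀ t, r (t + 2) = σ * r t := by
    intro t
    simp only [hr, hg, hh, hq.fst, hq.snd, pa'']
    ring
  have hℓc : ((2 / ℓ : ℝ) : ℂ) * (ℓ / 2 : ℝ) = 1 := by
    rw [← Complex.ofReal_mul]
    have : 2 / ℓ * (ℓ / 2) = 1 := by field_simp
    rw [this, Complex.ofReal_one]
  have f1 : herm a r = 0 := by
    rw [hr, herm_lin_right hac hhc hgc, hg, herm_lin_right hac hac hbc, e1, hcl.fst, hcl.orth, hp]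
    linear_combination -(herm (deriv a) (deriv a)) * hℓc
  have f2 : herm b r = 0 := by
    rw [hr, herm_lin_right hbc hhc hgc, hg, herm_lin_right hbc hac hbc, e2, hcl.snd,
      ← herm_conj a b, hcl.orth, hqe]
    simp only [map_zero, mul_zero, zero_add]
    linear_combination -(herm (deriv b) (deriv a)) * hℓc
  have f3 : herm r r = herm h r := by
    have hgr : herm g r = 0 := by
      rw [hg, herm_lin_left hrc hac hbc, f1, f2, mul_zero, mul_zero, add_zero]
    nth_rw 1 [hr]
    rw [herm_lin_left hrc hhc hgc, hgr, map_one, one_mul, mul_zero, add_zero]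
  have hr0 : herm r r = 0 := by
    by_contra hne
    obtain ⟨N, hN⟩ : ∃ N : ℝ, N = (herm r r).re := ⟨_, rfl⟩
    have hNe : herm r r = (N : ℂ) := by rw [hN, ← herm_self_eq_re]
    have hN0 : 0 < N := by
      refine lt_of_le_of_ne ?_ fun h0 => hne (by rw [hNe, ← h0, Complex.ofReal_zero])
      rw [hN, herm_self, Complex.ofReal_re]
      exact intervalIntegral.integral_nonneg two_pos.le fun t _ => Complex.normSq_nonneg _
    -- Scales `r` to squared norm `ℓ / 2`, as the variation requires.
    obtain ⟨κ, hκ⟩ : ∃ κ : ℝ, κ = √(ℓ / 2 / N) := ⟨_, rfl⟩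
    have hκ0 : 0 < κ := by rw [hκ]; positivity
    have hκ2 : κ * κ * N = ℓ / 2 := by
      rw [hκ, Real.mul_self_sqrt (by positivity)]
      field_simp
    have hα : ContDiff ℝ ∞ fun t => (κ : ℂ) * r t + 0 * r t :=
      (contDiff_const.mul hrs).add (contDiff_const.mul hrs)
    have pα : ∀ t, (κ : ℂ) * r (t + 2) + 0 * r (t + 2) = σ * ((κ : ℂ) * r t + 0 * r t) := by
      intro t
      rw [pr]
      ring
    have hv := herm_deriv_re_eq_zero_of_isCriticalPoint hy hq hcrit hα pα
      (by rw [herm_lin_right hac hrc hrc, f1]; simp) (by rw [herm_lin_right hbc hrc hrc, f2]; simp)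
      (by
        rw [herm_lin_left hα.continuous hrc hrc, herm_lin_right hrc hrc hrc, hNe, ← hκ2]
        simp
        ring)
    have hip := herm_deriv_left hq.sign ha' hα pa' pα
    rw [← neg_eq_iff_eq_neg, ← herm_neg_left, ← hh, herm_lin_right hhc hrc hrc, ← f3, hNe] at hip
    rw [← hip] at hv
    simp at hv
    rcases hv with hv | hv
    · exact hκ0.ne' hv
    · exact hN0.ne' hv
  have hz := eq_zero_of_herm_self hrc pr hq.sign hr0 t
  simp only [hr, hg, hh] at hz
  rw [← hp, ← hqe]
  linear_combination hz

/-- The rotation by a half turn about the third axis exchanges the components of a spinor. -/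
theorem exists_congruent_isSpinor_swap {ℓ : ℝ} {y : FramedLoop ℓ} {a b : ℝ → ℂ}
    (hy : IsSpinor y a b) :
    ∃ z : FramedLoop ℓ, Congruent y z ∧ IsSpinor z b (fun t => -a t) := by
  obtain ⟨e, he⟩ : ∃ e : E3, e = !₂[0, 0, 1] := ⟨_, rfl⟩
  have he1 : ‖e‖ = 1 := by rw [he, norm_vec3]; simp
  have he0 : e ≠ 0 := by
    rw [← norm_ne_zero_iff, he1]
    exact one_ne_zero
  have hR : ∀ u v w : ℝ, (ℝ ∙ e).reflection !₂[u, v, w] = !₂[-u, -v, w] := by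
    intro u v w
    rw [Submodule.reflection_singleton_apply, he1, he, inner_vec3]
    ext i
    fin_cases i <;> simp
    ring
  refine ⟨y.rotate (ℝ ∙ e).reflection, y.congruent_rotate (det_reflection_span_singleton he0),
    hy.smooth_snd, hy.smooth_fst.neg, fun t => ?_, fun t => ?_⟩
  · change deriv (fun t => (ℝ ∙ e).reflection (y.curve t)) t = _
    rw [deriv_map', hy.tangent, spinTangent, hR, spinTangent]
    refine vec3_congr ?_ ?_ ?_ <;> simp <;> ring
  · change _ • (ℝ ∙ e).reflection (y.frame t) = _
    have hs : spinSpeed (b t) (-a t) = spinSpeed (a t) (b t) := by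
      simp [spinSpeed]
      ring
    rw [hs, ← map_smul, hy.frame, spinNormal, hR, spinNormal]
    refine vec3_congr ?_ ?_ ?_ <;> simp <;> ring

/-- The Euler-Lagrange equation for the second component of a critical spinor field. -/
theorem deriv_deriv_snd_of_isCriticalPoint {ℓ σ : ℝ} (hℓ : 0 < ℓ) {y : FramedLoop ℓ}
    {a b : ℝ → ℂ} (hy : IsSpinor y a b) (hq : IsQuasiPeriodic σ a b)
    (hcrit : IsCriticalPoint y.toModuli) (t : ℝ) :
    -deriv (deriv b) t = (2 / ℓ : ℝ) * herm (deriv a) (deriv b) * a t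
      + (2 / ℓ : ℝ) * herm (deriv b) (deriv b) * b t := by
  obtain ⟨z, hyz, hz⟩ := exists_congruent_isSpinor_swap hy
  have hm : z.toModuli = y.toModuli := (Quotient.sound (s := congruenceSetoid ℓ) hyz).symm
  have h := deriv_deriv_fst_of_isCriticalPoint hℓ hz
    ⟨hq.sign, hq.snd, fun t => by rw [hq.fst]; ring⟩ (hm ▸ hcrit) t
  have hd : deriv (fun t => -a t) = fun t => -deriv a t := funext fun t => deriv.fun_neg
  rw [h, hd, herm_neg_left]
  ring

/-! ### Classification of the critical energy levels -/

/-- A frequency occurring with multiplier `σ` has the parity of `σ`. -/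
def HasParity (σ : ℝ) (c : ℤ) : Prop := (σ = 1 ∧ c % 2 = 0) ∨ (σ = -1 ∧ c % 2 = 1)

/-- The multiplier over a period of length `2` makes `2z` an even multiple of `π` when `σ = 1` and
an odd one when `σ = -1`. -/
theorem exists_int_of_exp_eq {σ : ℝ} (hσ : σ = 1 ∨ σ = -1) {z : ℂ}
    (h : Complex.exp (2 * (z * Complex.I)) = σ) :
    ∃ c : ℤ, HasParity σ c ∧ z = ((Real.pi * c / 2 : ℝ) : ℂ) := by
  rcases hσ with rfl | rfl
  · rw [Complex.ofReal_one, Complex.exp_eq_one_iff] at h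
    obtain ⟨n, hn⟩ := h
    refine ⟨2 * n, Or.inl ⟨rfl, by omega⟩, ?_⟩
    have hI := Complex.I_ne_zero
    apply mul_right_cancel₀ hI
    push_cast
    linear_combination hn / 2
  · rw [Complex.ofReal_neg, Complex.ofReal_one, ← Complex.exp_pi_mul_I,
      Complex.exp_eq_exp_iff_exists_int] at h
    obtain ⟨n, hn⟩ := h
    refine ⟨2 * n + 1, Or.inr ⟨rfl, by omega⟩, ?_⟩
    have hI := Complex.I_ne_zero
    apply mul_right_cancel₀ hI
    push_cast
    linear_combination hn / 2

theorem eq_mul_exp_of_hasDerivAt {g : ℝ → ℂ} {μ : ℂ} (h : ∀ t, HasDerivAt g (μ * g t) t) (t : ℝ) :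
    g t = g 0 * Complex.exp (t * μ) := by
  have hd : ∀ t : ℝ, HasDerivAt (fun t : ℝ => g t * Complex.exp (-(t * μ))) 0 t := by
    intro t
    have h1 : HasDerivAt (fun t : ℝ => (t : ℂ) * μ) μ t := by
      simpa using (Complex.ofRealCLM.hasDerivAt (x := t)).mul_const μ
    exact ((h t).mul h1.neg.cexp).congr_deriv (by ring)
  have hc := is_const_of_deriv_eq_zero (fun t => (hd t).differentiableAt)
    (fun t => (hd t).deriv) t 0
  simp only [Complex.ofReal_zero, zero_mul, neg_zero, Complex.exp_zero, mul_one] at hc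
  rw [← hc, mul_assoc, ← Complex.exp_add]
  simp

/-- The eigenvalues of `-d²/dt²` on functions with `f (t + 2) = σ f t`. -/
theorem exists_int_of_eigenfunction {σ lam : ℝ} (hσ : σ = 1 ∨ σ = -1) {f : ℝ → ℂ}
    (hf : ContDiff ℝ ∞ f) (pf : ∀ t, f (t + 2) = σ * f t) {t₀ : ℝ} (h0 : f t₀ ≠ 0)
    (he : ∀ t, -deriv (deriv f) t = lam * f t) :
    ∃ c : ℤ, HasParity σ c ∧ lam = (Real.pi * c / 2) ^ 2 := by
  have hf' := (contDiff_infty_iff_deriv.1 hf).2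
  have d0 := fun t => (hf.differentiable (by simp) t).hasDerivAt
  have d1 := fun t => (hf'.differentiable (by simp) t).hasDerivAt
  have pf' := deriv_quasiPeriodic pf
  obtain ⟨z, hz⟩ := IsAlgClosed.exists_pow_nat_eq (lam : ℂ) (n := 2) two_pos
  have step : ∀ {g : ℝ → ℂ} {w : ℂ}, w ^ 2 = lam → (∀ t, HasDerivAt g (w * Complex.I * g t) t) →
      (∀ t, g (t + 2) = σ * g t) → (∃ t, g t ≠ 0) →
      ∃ c : ℤ, HasParity σ c ∧ lam = (Real.pi * c / 2) ^ 2 := by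
    intro g w hw hg pg ⟨t, ht⟩
    have h1 := eq_mul_exp_of_hasDerivAt hg
    have h2 : Complex.exp (2 * (w * Complex.I)) = σ := by
      have h3 := pg t
      rw [h1 (t + 2), Complex.ofReal_add, add_mul, Complex.exp_add, ← mul_assoc, ← h1 t] at h3
      apply mul_left_cancel₀ ht
      rw [mul_comm (g t) (σ : ℂ), ← h3]
      simp
    obtain ⟨c, hc, hwc⟩ := exists_int_of_exp_eq hσ h2
    refine ⟨c, hc, ?_⟩
    rw [hwc] at hw
    exact_mod_cast hw.symm
  -- Factorization of `d²/dt² + w²` into first-order operators: `f' + iwf` solves `g' = iwg`, so a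
  -- nonzero instance is an exponential whose multiplier fixes `w`. No sign of `lam` is assumed; `w`
  -- may be complex a priori.
  have hpm : ∀ w : ℂ, w ^ 2 = lam → ∀ t, HasDerivAt (fun t => deriv f t + w * Complex.I * f t)
      (w * Complex.I * (deriv f t + w * Complex.I * f t)) t := by
    intro w hw t
    refine ((d1 t).add ((d0 t).const_mul (w * Complex.I))).congr_deriv ?_
    linear_combination -he t + hw * f t - w ^ 2 * f t * Complex.I_sq
  have pg : ∀ w : ℂ, ∀ t, deriv f (t + 2) + w * Complex.I * f (t + 2)
      = σ * (deriv f t + w * Complex.I * f t) := by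
    intro w t
    rw [pf, pf']
    ring
  by_cases hA : ∃ t, deriv f t + z * Complex.I * f t ≠ 0
  · exact step hz (hpm z hz) (pg z) hA
  by_cases hB : ∃ t, deriv f t + -z * Complex.I * f t ≠ 0
  · exact step (by rw [neg_sq, hz]) (hpm (-z) (by rw [neg_sq, hz])) (pg (-z)) hB
  -- If both first-order combinations vanish, then `f' = 0` and `z = 0`, and the constant `f` itself
  -- serves as the exponential.
  · push Not at hA hB
    have hd : ∀ t, deriv f t = 0 := fun t => by linear_combination (hA t + hB t) / 2
    have hz0 : z = 0 := by
      have h1 := hA t₀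
      rw [hd, zero_add] at h1
      simpa [h0] using h1
    refine step hz (g := f) (fun t => ?_) pf ⟨t₀, h0⟩
    rw [hz0, zero_mul, zero_mul, ← hd t]
    exact d0 t

theorem HasParity.modEq {σ : ℝ} {c d : ℤ} (hc : HasParity σ c) (hd : HasParity σ d) :
    c ≡ d [ZMOD 2] := by
  rcases hc with ⟨h1, h2⟩ | ⟨h1, h2⟩ <;> rcases hd with ⟨h3, h4⟩ | ⟨h3, h4⟩
  · exact h2.trans h4.symm
  · rw [h1] at h3; norm_num at h3
  · rw [h1] at h3; norm_num at h3
  · exact h2.trans h4.symm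

/-- By the Euler–Lagrange equations `-d²/dt²` preserves the span of `a` and `b`. Both eigenvalues
are squares of frequencies for the same `σ`, which explains the parity condition, and the energy is
read off from their sum. -/
theorem exists_int_of_mem_criticalEnergyLevels {ℓ e : ℝ} (hℓ : 0 < ℓ)
    (he : e ∈ criticalEnergyLevels ℓ) :
    ∃ c d : ℤ, c ≡ d [ZMOD 2] ∧ ¬(c = 0 ∧ d = 0) ∧
      e = ℓ * (Real.pi ^ 2 * ((c : ℝ) ^ 2 + (d : ℝ) ^ 2) / 2) := by
  obtain ⟨m, hm, rfl⟩ := he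
  obtain ⟨x, rfl⟩ : ∃ x : FramedLoop ℓ, x.toModuli = m := Quotient.exists_rep m
  obtain ⟨y, a, b, σ, hxy, hy, hq⟩ := x.exists_congruent_isSpinor
  have hxy' : x.toModuli = y.toModuli := Quotient.sound (s := congruenceSetoid ℓ) hxy
  rw [hxy'] at hm ⊢
  have hE : moduliEnergy y.toModuli = energy y.curve y.frame := rfl
  rw [hE, hy.energy_eq_herm]
  have hcl := hy.isClosedSpinor
  have hac := hy.smooth_fst.continuous
  have hbc := hy.smooth_snd.continuous
  have EL1 := deriv_deriv_fst_of_isCriticalPoint hℓ hy hq hm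
  have EL2 := deriv_deriv_snd_of_isCriticalPoint hℓ hy hq hm
  -- The scaled Gram matrix of `a', b'`. Its columns hold the coefficients of `-a''` and `-b''`, so
  -- an eigenvector `u` makes `u 0 · a + u 1 · b` an eigenfunction of `-d²/dt²`.
  let M : Matrix (Fin 2) (Fin 2) ℂ :=
    !![(2 / ℓ : ℝ) * herm (deriv a) (deriv a), (2 / ℓ : ℝ) * herm (deriv a) (deriv b);
      (2 / ℓ : ℝ) * herm (deriv b) (deriv a), (2 / ℓ : ℝ) * herm (deriv b) (deriv b)]
  have hM : M.IsHermitian := by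
    ext i j
    fin_cases i <;> fin_cases j <;> simp [M, herm_conj]
  have hℓc : ((ℓ / 2 : ℝ) : ℂ) ≠ 0 := by
    rw [Complex.ofReal_ne_zero]
    positivity
  have key : ∀ j, ∃ c : ℤ, HasParity σ c ∧ hM.eigenvalues j = (Real.pi * c / 2) ^ 2 := by
    intro j
    obtain ⟨u, hu⟩ : ∃ u : Fin 2 → ℂ, u = (hM.eigenvectorBasis j).ofLp := ⟨_, rfl⟩
    have hev := hM.mulVec_eigenvectorBasis j
    obtain ⟨lam, hlam⟩ : ∃ lam, lam = hM.eigenvalues j := ⟨_, rfl⟩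
    rw [← hu, ← hlam] at hev
    rw [← hlam]
    have hu0 : ¬(u 0 = 0 ∧ u 1 = 0) := by
      rintro ⟨h0, h1⟩
      refine hM.eigenvectorBasis.orthonormal.ne_zero j ?_
      ext i
      rw [← hu]
      fin_cases i
      exacts [h0, h1]
    have v0 := congrFun hev 0
    have v1 := congrFun hev 1
    simp [M, Matrix.mulVec, dotProduct, Fin.sum_univ_two] at v0 v1
    obtain ⟨f, hf⟩ : ∃ f : ℝ → ℂ, f = fun t => u 0 * a t + u 1 * b t := ⟨_, rfl⟩
    have hfs : ContDiff ℝ ∞ f := hf ▸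
      (contDiff_const.mul hy.smooth_fst).add (contDiff_const.mul hy.smooth_snd)
    -- The components are orthogonal with positive norm, hence linearly independent.
    have hf0 : ∃ t, f t ≠ 0 := by
      by_contra hcon
      push Not at hcon
      have hz : f = fun _ => 0 := funext hcon
      have g0 : herm a f = 0 := by simp [hz, herm]
      have g1 : herm b f = 0 := by simp [hz, herm]
      rw [hf, herm_lin_right hac hac hbc, hcl.fst, hcl.orth] at g0
      rw [hf, herm_lin_right hbc hac hbc, hcl.snd, ← herm_conj a b, hcl.orth] at g1
      simp only [map_zero, mul_zero, add_zero, zero_add] at g0 g1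
      exact hu0 ⟨(mul_eq_zero.1 g0).resolve_right hℓc, (mul_eq_zero.1 g1).resolve_right hℓc⟩
    obtain ⟨t₀, ht₀⟩ := hf0
    have da := fun t => (hy.smooth_fst.differentiable (by simp) t).hasDerivAt
    have db := fun t => (hy.smooth_snd.differentiable (by simp) t).hasDerivAt
    have da' := fun t => ((contDiff_infty_iff_deriv.1 hy.smooth_fst).2.differentiable
      (by simp) t).hasDerivAt
    have db' := fun t => ((contDiff_infty_iff_deriv.1 hy.smooth_snd).2.differentiable
      (by simp) t).hasDerivAt
    have d1 : deriv f = fun t => u 0 * deriv a t + u 1 * deriv b t := by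
      rw [hf]
      exact funext fun t => (((da t).const_mul _).add ((db t).const_mul _)).deriv
    have d2 : ∀ t, deriv (deriv f) t = u 0 * deriv (deriv a) t + u 1 * deriv (deriv b) t := by
      rw [d1]
      exact fun t => (((da' t).const_mul _).add ((db' t).const_mul _)).deriv
    refine exists_int_of_eigenfunction hq.sign hfs (fun t => ?_) ht₀ fun t => ?_
    · simp only [hf, hq.fst, hq.snd]
      ring
    · rw [d2, hf]
      have l1 := EL1 t
      have l2 := EL2 t
      push_cast at l1 l2
      linear_combination u 0 * l1 + u 1 * l2 + a t * v0 + b t * v1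
  have htr := congrArg Complex.re hM.trace_eq_sum_eigenvalues
  obtain ⟨c, hc, hc'⟩ := key 0
  obtain ⟨d, hd, hd'⟩ := key 1
  rw [Matrix.trace_fin_two, Fin.sum_univ_two, hc', hd'] at htr
  change ((2 / ℓ : ℝ) * herm (deriv a) (deriv a) + (2 / ℓ : ℝ) * herm (deriv b) (deriv b) : ℂ).re
    = (((Real.pi * c / 2) ^ 2 : ℝ) + ((Real.pi * d / 2) ^ 2 : ℝ) : ℂ).re at htr
  rw [Complex.add_re, Complex.re_ofReal_mul, Complex.re_ofReal_mul, Complex.add_re,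
    Complex.ofReal_re, Complex.ofReal_re] at htr
  refine ⟨c, d, hc.modEq hd, ?_, ?_⟩
  -- Zero trace forces `a' = b' = 0`; the constants `a` and `b` are nonzero by their norms,
  -- contradicting orthogonality.
  · rintro ⟨rfl, rfl⟩
    have hnn : ∀ f, 0 ≤ (herm f f).re := fun f => by
      rw [herm_self, Complex.ofReal_re]
      exact intervalIntegral.integral_nonneg two_pos.le fun t _ => Complex.normSq_nonneg _
    have hA := hnn (deriv a)
    have hB := hnn (deriv b)
    have hsum : (herm (deriv a) (deriv a)).re + (herm (deriv b) (deriv b)).re = 0 := by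
      have h2 : 2 / ℓ ≠ 0 := by positivity
      apply mul_left_cancel₀ h2
      linear_combination htr + (by simp : (Real.pi * ((0 : ℤ) : ℝ) / 2) ^ 2 = 0)
        + (by simp : (Real.pi * ((0 : ℤ) : ℝ) / 2) ^ 2 = 0)
    have hza : herm (deriv a) (deriv a) = 0 := by
      rw [herm_self_eq_re, Complex.ofReal_eq_zero]; linarith
    have hzb : herm (deriv b) (deriv b) = 0 := by
      rw [herm_self_eq_re, Complex.ofReal_eq_zero]; linarith
    have hconst : ∀ {f : ℝ → ℂ}, ContDiff ℝ ∞ f → (∀ t, f (t + 2) = σ * f t) →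
        herm (deriv f) (deriv f) = 0 → ∀ t, f t = f 0 := by
      intro f hf pf hz t
      exact is_const_of_deriv_eq_zero (hf.differentiable (by simp))
        (eq_zero_of_herm_self (contDiff_infty_iff_deriv.1 hf).2.continuous
          (deriv_quasiPeriodic pf) hq.sign hz) t 0
    have ca := hconst hy.smooth_fst hq.fst hza
    have cb := hconst hy.smooth_snd hq.snd hzb
    have ha0 : a 0 ≠ 0 := fun h => hℓc (by rw [← hcl.fst]; simp [herm, ca, h])
    have hb0 : b 0 ≠ 0 := fun h => hℓc (by rw [← hcl.snd]; simp [herm, cb, h])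
    have ho := hcl.orth
    simp [herm, ca, cb, ha0, hb0] at ho
  · field_simp at htr ⊢
    linear_combination htr

end FramedCurve

end

theorem mainTheorem3 (ℓ : ℝ) (hℓ : 0 < ℓ) :
    FramedCurve.criticalEnergyLevels ℓ =
      {e : ℝ | ∃ c d : ℤ, c ≡ d [ZMOD 2] ∧ ¬ (c = 0 ∧ d = 0) ∧
        e = ℓ * (Real.pi ^ 2 * ((c : ℝ) ^ 2 + (d : ℝ) ^ 2) / 2)} := by
  ext e
  refine ⟨FramedCurve.exists_int_of_mem_criticalEnergyLevels hℓ, ?_⟩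
  rintro ⟨c, d, hcd, h0, rfl⟩
  exact FramedCurve.mem_criticalEnergyLevels hℓ hcd h0
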